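/- Let $V:\mathbb R^3\to[0,\infty)$ be a smooth, symmetric ($V(-x)=V(x)$), nonnegative potential of fast decay ($\sup_x |x|^kV(x)<\infty$ for every $k\ge 0$). Let $1-w$ be its zero energy scattering solution, i.e. $-\Delta(1-w)+V(1-w)=0$ on $\mathbb R^3$ with $0\le w<1$ and $w(x)\to 0$ as $|x|\to\infty$, let $a=\frac1{4\pi}\int_{\mathbb R^3}V(1-w)\,dx$ be the scattering length, and $g_0=4\pi a$. For a cube $\Lambda=[0,L]^3$ and a density $\rho>0$ such that $N=\rho L^3$ is an integer, let $$e_0^P(\rho,\Lambda)=\tfrac1N\inf\operatorname{spec}H_N^P,\qquad e_0^D(\rho,\Lambda)=\tfrac1N\inf\operatorname{spec}H_N^D$$ be the ground state energies per particle of $N$ bosons in $\Lambda$, where, on the space of permutation-invariant functions in $L^2(\Lambda^N)$, $$H^P_N=\sum_{i=1}^N(-\Delta_i)+\sum_{i\ne j}V^{P}(x_i-x_j)\ \text{ (periodic boundary conditions)},\qquad H^D_N=\sum_{i=1}^N(-\Delta_i)+\sum_{i\ne j}V(x_i-x_j)\ \text{ (Dirichlet boundary conditions)},$$ $V^P(x)=\sum_{n\in\mathbb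 Z^3}V(x+nL)$, and the sums over $i\neq j$ run over ordered pairs. For $\rho>0$ put $L=\rho^{-25/24}$, $\Lambda=[0,L]^3$, $\widetilde L=L(1+2\rho^{25/48})$, $\widetilde\Lambda=[0,\widetilde L]^3$ and $\widetilde\rho=\rho L^3/\widetilde L^3$. Here and below $\rho\to0$ runs through the $\rho>0$ for which $N=\rho L^3=\widetilde\rho\,\widetilde L^3$ is an integer. Suppose that $$\limsup_{\rho\to0}\ \frac{e^P_0(\rho,\Lambda)-g_0\rho}{g_0^{5/2}\rho^{3/2}}\le\frac{16}{15\pi^2}.$$ Then $$\limsup_{\rho\to0}\ \frac{e^D_0(\widetilde\rho,\widetilde\Lambda)-g_0\widetilde\rho}{g_0^{5/2}\widetilde\rho^{\,3/2}}\le\frac{16}{15\pi^2}.$$ -/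

import Mathlib

open Filter Topology MeasureTheory
open scoped ContDiff Laplacian

namespace BoseGas

/-! ### Operators given by their graphs, Friedrichs extension, bottom of the spectrum -/

section Operators

variable {H : Type*} [NormedAddCommGroup H] [InnerProductSpace ℂ H]

/-- `T ⊆ H × H` is the graph `{(ψ, Tψ)}` of a symmetric, semibounded operator. This is the domain
of the closure of the quadratic form `⟨ψ, Tψ⟩`: the limits in `H` of sequences in the domain of
`T` that are Cauchy for the form. -/
def formDomain (T : Set (H × H)) : Set H :=
  {ψ | ∃ u : ℕ → H × H, (∀ n, u n ∈ T) ∧ Tendsto (fun n => (u n).1) atTop (𝓝 ψ) ∧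
    Tendsto (fun k : ℕ × ℕ =>
      inner ℂ ((u k.1).1 - (u k.2).1) ((u k.1).2 - (u k.2).2)) atTop (𝓝 0)}

/-- The graph of the adjoint of the operator with graph `T`. -/
def adjointGraph (T : Set (H × H)) : Set (H × H) :=
  {p | ∀ q ∈ T, inner ℂ q.2 p.1 = inner ℂ q.1 p.2}

/-- The graph of the Friedrichs extension of the operator with graph `T`: the restriction of the
adjoint to the part of its domain that lies in the form domain. -/
def friedrichs (T : Set (H × H)) : Set (H × H) :=
  {p | p ∈ adjointGraph T ∧ p.1 ∈ formDomain T}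

/-- The resolvent set of the operator with graph `A`: the `z` for which `A - z` is a bijection
from its domain onto `H`, with bounded inverse. -/
def graphResolventSet (A : Set (H × H)) : Set ℂ :=
  {z | (∀ g : H, ∃! ψ : H, (ψ, g + z • ψ) ∈ A) ∧
    ∃ C : ℝ, ∀ p ∈ A, ‖p.1‖ ≤ C * ‖p.2 - z • p.1‖}

/-- The infimum of the (real) spectrum of the operator with graph `A`. -/
noncomputable def infSpec (A : Set (H × H)) : ℝ :=
  sInf {x : ℝ | (x : ℂ) ∉ graphResolventSet A}

end Operators

/-! ### `N` bosons in a box -/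

/-- One-particle configuration space `ℝ³`. -/
abbrev Space : Type := EuclideanSpace ℝ (Fin 3)

/-- Configurations of `N` particles: `ℝ³ᴺ`, with coordinates indexed by particle and direction. -/
abbrev Config (N : ℕ) : Type := EuclideanSpace ℝ (Fin N × Fin 3)

/-- The position of the `i`-th particle. -/
noncomputable def particle {N : ℕ} (x : Config N) (i : Fin N) : Space :=
  WithLp.toLp 2 fun a => x (i, a)

/-- Relabelling of the particles. -/
noncomputable def permute {N : ℕ} (σ : Equiv.Perm (Fin N)) (x : Config N) : Config N :=
  WithLp.toLp 2 fun k => x (σ k.1, k.2)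

/-- The `N`-particle configurations in the cube `Λ = [0, L]³`. -/
def box (N : ℕ) (L : ℝ) : Set (Config N) := {x | ∀ k, x k ∈ Set.Icc 0 L}

/-- Lebesgue measure on `Λᴺ`. -/
noncomputable def boxMeasure (N : ℕ) (L : ℝ) : Measure (Config N) :=
  volume.restrict (box N L)

theorem measurePreserving_permute {N : ℕ} (L : ℝ) (σ : Equiv.Perm (Fin N)) :
    MeasurePreserving (permute σ) (boxMeasure N L) (boxMeasure N L) := by
  have h : MeasurePreserving (permute (N := N) σ) volume volume := by
    have h1 := (LinearIsometryEquiv.piLpCongrLeft 2 ℝ ℝ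
      ((Equiv.prodCongr σ (Equiv.refl (Fin 3))).symm)).measurePreserving
    have e : permute (N := N) σ = ⇑(LinearIsometryEquiv.piLpCongrLeft 2 ℝ ℝ
        ((Equiv.prodCongr σ (Equiv.refl (Fin 3))).symm)) := by
      ext x k
      rfl
    rw [e]
    exact h1
  have hm : MeasurableSet (box N L) := by
    have : box N L = ⋂ k, (fun x : Config N => x k) ⁻¹' Set.Icc 0 L := by
      ext x; simp [box]
    rw [this]
    refine MeasurableSet.iInter fun k => measurableSet_Icc.preimage ?_
    fun_prop
  have hp : permute σ ⁻¹' box N L = box N L := by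
    ext x
    constructor
    · intro hx k
      have := hx (σ.symm k.1, k.2)
      simpa [permute] using this
    · intro hx k
      exact hx (σ k.1, k.2)
  have := h.restrict_preimage hm
  rwa [hp] at this

/-- The Hilbert space of `N` bosons in `Λ = [0, L]³`: the square-integrable functions on `Λᴺ`
that are invariant under all permutations of the particles. -/
noncomputable def bosonSpace (N : ℕ) (L : ℝ) : Submodule ℂ (Lp ℂ 2 (boxMeasure N L)) where
  carrier := {Ψ | ∀ σ : Equiv.Perm (Fin N),
    (fun x => Ψ (permute σ x)) =ᵐ[boxMeasure N L] fun x => Ψ x}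
  zero_mem' σ := by
    have h0 := Lp.coeFn_zero ℂ 2 (boxMeasure N L)
    have h1 := (measurePreserving_permute L σ).quasiMeasurePreserving.ae h0
    filter_upwards [h0, h1] with x hx hx'
    rw [hx, hx']; rfl
  add_mem' {Ψ Φ} hΨ hΦ σ := by
    have h0 := Lp.coeFn_add Ψ Φ
    have h1 := (measurePreserving_permute L σ).quasiMeasurePreserving.ae h0
    filter_upwards [h0, h1, hΨ σ, hΦ σ] with x hx hx' h2 h3
    rw [hx, hx', Pi.add_apply, Pi.add_apply, h2, h3]
  smul_mem' c Ψ hΨ σ := by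
    have h0 := Lp.coeFn_smul c Ψ
    have h1 := (measurePreserving_permute L σ).quasiMeasurePreserving.ae h0
    filter_upwards [h0, h1, hΨ σ] with x hx hx' h2
    rw [hx, hx', Pi.smul_apply, Pi.smul_apply, h2]

/-- The differential expression `∑ᵢ (-Δᵢ) + ∑_{i ≠ j} W(xᵢ - xⱼ)`, the last sum being over ordered
pairs; `Δ` is the Laplacian of `ℝ³ᴺ`. -/
noncomputable def hamiltonianExpr {N : ℕ} (W : Space → ℝ) (ψ : Config N → ℂ) (x : Config N) : ℂ :=
  -(Δ ψ) x +
    ((∑ i, ∑ j ∈ Finset.univ.erase i, W (particle x i - particle x j) : ℝ) : ℂ) * ψ x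

/-- The Hamiltonian on the core `D`: the graph of the operator `ψ ↦ hamiltonianExpr W ψ` in the
space of bosons, for the permutation-invariant functions `ψ` in `D`. -/
def hamiltonianOn (N : ℕ) (L : ℝ) (W : Space → ℝ) (D : Set (Config N → ℂ)) :
    Set (bosonSpace N L × bosonSpace N L) :=
  {p | ∃ ψ ∈ D, (∀ (σ : Equiv.Perm (Fin N)) (x : Config N), ψ (permute σ x) = ψ x) ∧
    (p.1 : Lp ℂ 2 (boxMeasure N L)) =ᵐ[boxMeasure N L] ψ ∧
    (p.2 : Lp ℂ 2 (boxMeasure N L)) =ᵐ[boxMeasure N L] hamiltonianExpr W ψ}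

/-- Smooth functions on `ℝ³ᴺ` with period `L` in each coordinate. -/
def periodicCore (N : ℕ) (L : ℝ) : Set (Config N → ℂ) :=
  {ψ | ContDiff ℝ ∞ ψ ∧ ∀ (x : Config N) (k : Fin N × Fin 3),
    ψ (x + EuclideanSpace.single k L) = ψ x}

/-- Smooth functions on `ℝ³ᴺ` with compact support inside the open box `(0, L)³ᴺ`. -/
def dirichletCore (N : ℕ) (L : ℝ) : Set (Config N → ℂ) :=
  {ψ | ContDiff ℝ ∞ ψ ∧ HasCompactSupport ψ ∧
    tsupport ψ ⊆ {x | ∀ k, x k ∈ Set.Ioo 0 L}}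

/-- The potential on the torus of side `L`, `∑_{n ∈ ℤ³} V(x + nL)`. Its Fourier coefficients on
the torus are the values of the Fourier transform of `V` on `(2π/L)ℤ³`. -/
noncomputable def periodize (V : Space → ℝ) (L : ℝ) (x : Space) : ℝ :=
  ∑' n : Fin 3 → ℤ, V (x + WithLp.toLp 2 fun a => (n a : ℝ) * L)

/-- The Hamiltonian of `N` bosons in `[0, L]³` with periodic boundary conditions. -/
def periodicHamiltonian (V : Space → ℝ) (N : ℕ) (L : ℝ) :
    Set (bosonSpace N L × bosonSpace N L) :=
  friedrichs (hamiltonianOn N L (periodize V L) (periodicCore N L))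

/-- The Hamiltonian of `N` bosons in `[0, L]³` with Dirichlet boundary conditions. -/
def dirichletHamiltonian (V : Space → ℝ) (N : ℕ) (L : ℝ) :
    Set (bosonSpace N L × bosonSpace N L) :=
  friedrichs (hamiltonianOn N L V (dirichletCore N L))

/-- The number `N = ρ |Λ|` of particles in `Λ = [0, L]³` at density `ρ`; it is used only where
`ρ L³` is a natural number. -/
noncomputable def particleNumber (ρ L : ℝ) : ℕ := ⌊ρ * L ^ 3⌋₊

/-- `e₀ᴾ(ρ, Λ)`: the ground state energy per particle, periodic boundary conditions. -/
noncomputable def e0P (V : Space → ℝ) (ρ L : ℝ) : ℝ :=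
  infSpec (periodicHamiltonian V (particleNumber ρ L) L) / particleNumber ρ L

/-- `e₀ᴰ(ρ, Λ)`: the ground state energy per particle, Dirichlet boundary conditions. -/
noncomputable def e0D (V : Space → ℝ) (ρ L : ℝ) : ℝ :=
  infSpec (dirichletHamiltonian V (particleNumber ρ L) L) / particleNumber ρ L

/-! ### The potential and its scattering length -/

/-- Smooth, symmetric, nonnegative two-body potentials of fast decay. -/
structure IsInteractionPotential (V : Space → ℝ) : Prop where
  smooth : ContDiff ℝ ∞ V
  symm : ∀ x, V (-x) = V x
  nonneg : ∀ x, 0 ≤ V x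
  decay : ∀ k : ℕ, ∃ C : ℝ, ∀ x, ‖x‖ ^ k * V x ≤ C

/-- `1 - w` is the zero energy scattering solution of `V`. -/
structure IsScatteringSolution (V w : Space → ℝ) : Prop where
  smooth : ContDiff ℝ 2 w
  equation : ∀ x, -(Δ fun y => 1 - w y) x + V x * (1 - w x) = 0
  nonneg : ∀ x, 0 ≤ w x
  lt_one : ∀ x, w x < 1
  tendsto_zero : Tendsto w (cocompact Space) (𝓝 0)

/-- The scattering length `a = (4π)⁻¹ ∫ V (1 - w)`. -/
noncomputable def scatteringLength (V w : Space → ℝ) : ℝ :=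
  1 / (4 * Real.pi) * ∫ x, V x * (1 - w x)

/-- `g₀ = 4πa`. -/
noncomputable def g0 (V w : Space → ℝ) : ℝ := 4 * Real.pi * scatteringLength V w

/-! ### The scaling -/

/-- `L = ρ^(-25/24)`. -/
noncomputable def boxSide (ρ : ℝ) : ℝ := ρ ^ (-(25 / 24) : ℝ)

/-- `L̃ = L (1 + 2 ρ^(25/48))`. -/
noncomputable def boxSide' (ρ : ℝ) : ℝ := boxSide ρ * (1 + 2 * ρ ^ (25 / 48 : ℝ))

/-- `ρ̃ = ρ L³ / L̃³`. -/
noncomputable def density' (ρ : ℝ) : ℝ := ρ * boxSide ρ ^ 3 / boxSide' ρ ^ 3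

/-- The densities `ρ > 0` for which the box of side `ρ^(-25/24)` holds a whole number
`N = ρ L³` of particles. -/
def admissibleDensities : Set ℝ := {ρ | 0 < ρ ∧ ∃ N : ℕ, ρ * boxSide ρ ^ 3 = N}

end BoseGas

/-! A bosonic trial state ψ for the periodic box of side L becomes a Dirichlet trial state for the
box of side L + 2ℓ, with the same norm: extend ψ periodically and multiply it by ∏ q(x_k) over all
3N coordinates, where q is smooth, supported in (0, L + 2ℓ), and ∑ₙ q(t + nL)² = 1. Integrating a
periodic function against ∏ q(x_k)² over ℝ³ᴺ gives back its integral over one period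
(`integral_prodFun_smul`). Hence the norm and the V^P-energy are unchanged, and since 0 ≤ V ≤ V^P
the V-energy of the new state is no larger.

In the kinetic energy the cross term carries 2qq' = (q²)', whose periodization vanishes. What
remains is the expectation of ∑ₖ e(x_k), where e is the periodization of -qq''
(`integral_kinetic_prodFun_smul`). Pointwise one only expects e to be of order ℓ⁻², but its mean
over a period is L⁻¹∫(-qq'') = O(1/(ℓL)). Translating ψ by (a, …, a) costs no energy, so averaging
over a yields a translate whose localization error is at most 3N·C/(ℓL) times its squared norm
(`exists_average_le`, `exists_dirichlet_trial`).

To pass from trial states to spectra, the variational principle is proved for Friedrichs extensions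
of nonnegative symmetric relations: the bottom of the spectrum is at most every Rayleigh quotient on
the core (`infSpec_le`) and is approached by them (`exists_rayleigh_lt`). This gives
`exists_infSpec_dirichlet_le`.

Finally, with ℓ = Lρ^(25/48) and L = ρ^(-25/24) the error per particle is of order 1/(ℓL) =
ρ^(75/48), and ρ - ρ̃ = O(ρ^(73/48)). Both are o(ρ^(3/2)), and ρ/ρ̃ → 1, so the bound on the limit
superior survives. -/

namespace BoseGas

/-! ### Friedrichs extension of a nonnegative symmetric relation -/

section Friedrichs

variable {H : Type*} [NormedAddCommGroup H] [InnerProductSpace ℂ H]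

/-- A linear subspace of `H × H` that is the graph of a symmetric nonnegative linear relation. -/
structure IsNonnegSymmetric (S : Submodule ℂ (H × H)) : Prop where
  symm : ∀ p ∈ S, ∀ q ∈ S, inner ℂ p.2 q.1 = inner ℂ p.1 q.2
  nonneg : ∀ p ∈ S, 0 ≤ (inner ℂ p.1 p.2).re

variable {S : Submodule ℂ (H × H)}

namespace IsNonnegSymmetric

theorem inner_im (hS : IsNonnegSymmetric S) {p : H × H} (hp : p ∈ S) :
    (inner ℂ p.1 p.2).im = 0 := by
  have h := hS.symm p hp p hp
  rw [← inner_conj_symm] at h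
  exact Complex.conj_eq_iff_im.mp h

theorem norm_inner (hS : IsNonnegSymmetric S) {p : H × H} (hp : p ∈ S) :
    ‖(inner ℂ p.1 p.2 : ℂ)‖ = (inner ℂ p.1 p.2).re := by
  have h : (inner ℂ p.1 p.2 : ℂ) = ((inner ℂ p.1 p.2).re : ℂ) :=
    Complex.ext rfl (by simp [hS.inner_im hp])
  rw [h, Complex.norm_real, Real.norm_of_nonneg (hS.nonneg p hp), Complex.ofReal_re]

theorem re_inner_add (hS : IsNonnegSymmetric S) {p q : H × H} (hp : p ∈ S) (hq : q ∈ S) (t : ℝ) :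
    (inner ℂ (p + (t : ℂ) • q).1 (p + (t : ℂ) • q).2).re =
      (inner ℂ p.1 p.2).re + 2 * t * (inner ℂ q.2 p.1).re + t ^ 2 * (inner ℂ q.1 q.2).re := by
  have h1 : (inner ℂ p.1 q.2).re = (inner ℂ q.2 p.1).re := by
    rw [← inner_conj_symm, Complex.conj_re]
  have h2 : (inner ℂ q.1 p.2).re = (inner ℂ q.2 p.1).re := by
    rw [hS.symm q hq p hp]
  simp only [Prod.fst_add, Prod.snd_add, Prod.smul_fst, Prod.smul_snd, inner_add_left,
    inner_add_right, inner_smul_left, inner_smul_right, Complex.add_re, Complex.conj_ofReal,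
    Complex.re_ofReal_mul, h1, h2]
  ring

theorem parallelogram (hS : IsNonnegSymmetric S) {p q : H × H} (hp : p ∈ S) (hq : q ∈ S) :
    (inner ℂ (p + q).1 (p + q).2).re + (inner ℂ (p - q).1 (p - q).2).re =
      2 * (inner ℂ p.1 p.2).re + 2 * (inner ℂ q.1 q.2).re := by
  have h1 := hS.re_inner_add hp hq 1
  have h2 := hS.re_inner_add hp hq (-1)
  simp only [Complex.ofReal_one, one_smul, Complex.ofReal_neg, neg_smul, ← sub_eq_add_neg] at h1 h2
  rw [h1, h2]
  ring

/-- Cauchy–Schwarz for the quadratic form. -/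
theorem norm_inner_sq_le (hS : IsNonnegSymmetric S) {p q : H × H} (hp : p ∈ S) (hq : q ∈ S) :
    ‖(inner ℂ p.2 q.1 : ℂ)‖ ^ 2 ≤ (inner ℂ p.1 p.2).re * (inner ℂ q.1 q.2).re := by
  let c : PreInnerProductSpace.Core ℂ S :=
    { inner := fun p q => inner ℂ p.1.1 q.1.2
      conj_inner_symm := fun p q => by
        change starRingEnd ℂ (inner ℂ q.1.1 p.1.2) = inner ℂ p.1.1 q.1.2
        rw [inner_conj_symm, hS.symm p.1 p.2 q.1 q.2]
      re_inner_nonneg := fun p => hS.nonneg p.1 p.2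
      add_left := fun p q r => by
        change inner ℂ (p.1.1 + q.1.1) r.1.2 = _
        rw [inner_add_left]
      smul_left := fun p q r => by
        change inner ℂ (r • p.1.1) q.1.2 = _
        rw [inner_smul_left] }
  have h := @InnerProductSpace.Core.inner_mul_inner_self_le ℂ S _ _ _ c ⟨p, hp⟩ ⟨q, hq⟩
  change ‖(inner ℂ p.1 q.2 : ℂ)‖ * ‖(inner ℂ q.1 p.2 : ℂ)‖ ≤
    (inner ℂ p.1 p.2).re * (inner ℂ q.1 q.2).re at h
  rw [hS.symm p hp q hq, sq]
  convert h using 2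
  rw [← hS.symm p hp q hq, ← inner_conj_symm, RCLike.norm_conj]

theorem zero_mem_formDomain : (0 : H) ∈ formDomain (S : Set (H × H)) :=
  ⟨fun _ => 0, fun _ => S.zero_mem, by simp, by simp⟩

/-- The parallelogram law gives q(u + v) ≤ 2q(u) + 2q(v), so sums of form-Cauchy sequences are
form-Cauchy. -/
theorem add_mem_formDomain (hS : IsNonnegSymmetric S) {φ ψ : H}
    (hφ : φ ∈ formDomain (S : Set (H × H))) (hψ : ψ ∈ formDomain (S : Set (H × H))) :
    φ + ψ ∈ formDomain (S : Set (H × H)) := by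
  obtain ⟨u, hu, hu1, hu2⟩ := hφ
  obtain ⟨v, hv, hv1, hv2⟩ := hψ
  refine ⟨fun n => u n + v n, fun n => S.add_mem (hu n) (hv n), hu1.add hv1, ?_⟩
  have h := (hu2.norm.const_mul 2).add (hv2.norm.const_mul 2)
  simp only [norm_zero, mul_zero, add_zero] at h
  refine squeeze_zero_norm (fun k => ?_) h
  have hp : u k.1 - u k.2 ∈ S := S.sub_mem (hu _) (hu _)
  have hq : v k.1 - v k.2 ∈ S := S.sub_mem (hv _) (hv _)
  have e : ∀ a b c d : H × H, inner ℂ ((a + b).1 - (c + d).1) ((a + b).2 - (c + d).2) =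
      inner ℂ ((a - c) + (b - d)).1 ((a - c) + (b - d)).2 := by
    intro a b c d
    simp only [Prod.fst_add, Prod.snd_add, Prod.fst_sub, Prod.snd_sub]
    congr 1 <;> abel
  rw [e, hS.norm_inner (S.add_mem hp hq)]
  have h3 := hS.norm_inner hp
  have h4 := hS.norm_inner hq
  simp only [Prod.fst_sub, Prod.snd_sub] at h3 h4
  rw [h3, h4]
  have := hS.parallelogram hp hq
  have := hS.nonneg _ (S.sub_mem hp hq)
  simp only [Prod.fst_sub, Prod.snd_sub] at *
  linarith

theorem smul_mem_formDomain (c : ℂ) {φ : H} (hφ : φ ∈ formDomain (S : Set (H × H))) :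
    c • φ ∈ formDomain (S : Set (H × H)) := by
  obtain ⟨u, hu, hu1, hu2⟩ := hφ
  refine ⟨fun n => c • u n, fun n => S.smul_mem c (hu n), hu1.const_smul c, ?_⟩
  have h := hu2.const_mul (starRingEnd ℂ c * c)
  rw [mul_zero] at h
  refine h.congr fun k => ?_
  simp only [Prod.smul_fst, Prod.smul_snd, ← smul_sub, inner_smul_left, inner_smul_right]
  ring

/-- The Friedrichs extension of a nonnegative symmetric relation, as a linear relation. -/
def extension (hS : IsNonnegSymmetric S) : Submodule ℂ (H × H) where
  carrier := friedrichs (S : Set (H × H))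
  zero_mem' := ⟨fun q _ => by simp, zero_mem_formDomain⟩
  add_mem' {p p'} hp hp' := ⟨fun q hq => by
    simp only [Prod.fst_add, Prod.snd_add, inner_add_right, hp.1 q hq, hp'.1 q hq],
    hS.add_mem_formDomain hp.2 hp'.2⟩
  smul_mem' c p hp := ⟨fun q hq => by
    simp only [Prod.smul_fst, Prod.smul_snd, inner_smul_right, hp.1 q hq],
    smul_mem_formDomain c hp.2⟩

theorem le_extension (hS : IsNonnegSymmetric S) : S ≤ hS.extension := fun p hp =>
  ⟨fun q hq => hS.symm q hq p hp, fun _ => p, fun _ => hp, tendsto_const_nhds, by simp⟩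

/-- The quadratic form of the Friedrichs extension is the limit of the form along approximating
sequences. -/
theorem tendsto_form (hS : IsNonnegSymmetric S) {p : H × H} (hp : p ∈ hS.extension)
    {u : ℕ → H × H} (hu : ∀ n, u n ∈ S) (hu1 : Tendsto (fun n => (u n).1) atTop (𝓝 p.1))
    (hu2 : Tendsto (fun k : ℕ × ℕ =>
      inner ℂ ((u k.1).1 - (u k.2).1) ((u k.1).2 - (u k.2).2)) atTop (𝓝 0)) :
    Tendsto (fun n => inner ℂ (u n).1 (u n).2) atTop (𝓝 (inner ℂ p.1 p.2)) := by
  have hlim : Tendsto (fun n => inner ℂ (u n).2 p.1) atTop (𝓝 (inner ℂ p.1 p.2)) := by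
    have h : Tendsto (fun n => inner ℂ (u n).1 p.2) atTop (𝓝 (inner ℂ p.1 p.2)) :=
      hu1.inner tendsto_const_nhds
    exact h.congr fun n => (hp.1 (u n) (hu n)).symm
  -- The vector p.1 - (u n).1 is the limit of (u k).1 - (u n).1 in k, and Cauchy–Schwarz for the
  -- form bounds the pairing of (u n).2 with the latter by √(q(u n) q(u k - u n)), where the first
  -- factor is bounded and the second is small.
  have hdiff : Tendsto (fun n => inner ℂ (u n).2 p.1 - inner ℂ (u n).2 (u n).1) atTop (𝓝 0) := by
    have hcau : ∀ ε > 0, ∃ K, ∀ n ≥ K, ∀ k ≥ K,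
        (inner ℂ (u n - u k).1 (u n - u k).2).re < ε := by
      intro ε hε
      obtain ⟨K, hK⟩ := Metric.tendsto_atTop.mp hu2 ε hε
      refine ⟨max K.1 K.2, fun n hn k hk => ?_⟩
      have := hK (n, k) ⟨(le_max_left _ _).trans hn, (le_max_right _ _).trans hk⟩
      rw [dist_zero_right] at this
      exact (Complex.re_le_norm _).trans_lt this
    obtain ⟨K₀, hK₀⟩ := hcau 1 one_pos
    -- From q(u n) ≤ 2q(u K₀) + 2q(u n - u K₀), the last form value being below 1.
    set M := 2 * (inner ℂ (u K₀).1 (u K₀).2).re + 2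
    have hM : 0 < M := by
      have := hS.nonneg _ (hu K₀)
      positivity
    have hb : ∀ n ≥ K₀, (inner ℂ (u n).1 (u n).2).re ≤ M := by
      intro n hn
      have h1 := hS.parallelogram (hu K₀) (S.sub_mem (hu n) (hu K₀))
      have h2 := hS.nonneg _ (S.sub_mem (hu K₀) (S.sub_mem (hu n) (hu K₀)))
      have h3 := hK₀ n hn K₀ le_rfl
      rw [add_sub_cancel] at h1
      simp only [M]
      linarith
    rw [Metric.tendsto_atTop]
    intro ε hε
    obtain ⟨K, hK⟩ := hcau ((ε / 2) ^ 2 / M) (by positivity)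
    refine ⟨max K K₀, fun n hn => ?_⟩
    have hn1 : n ≥ K := (le_max_left _ _).trans hn
    have hn2 : n ≥ K₀ := (le_max_right _ _).trans hn
    rw [dist_zero_right]
    have hl : Tendsto (fun k => ‖(inner ℂ (u n).2 ((u k).1 - (u n).1) : ℂ)‖) atTop
        (𝓝 ‖(inner ℂ (u n).2 (p.1 - (u n).1) : ℂ)‖) :=
      (tendsto_const_nhds.inner (hu1.sub tendsto_const_nhds)).norm
    rw [← inner_sub_right]
    refine lt_of_le_of_lt (le_of_tendsto hl ?_) (half_lt_self hε)
    filter_upwards [eventually_ge_atTop K] with k hk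
    refine abs_le_of_sq_le_sq' ?_ (by positivity) |>.2
    have h1 := hS.norm_inner_sq_le (hu n) (S.sub_mem (hu k) (hu n))
    refine h1.trans ?_
    calc _ ≤ M * ((ε / 2) ^ 2 / M) := mul_le_mul (hb n hn2) (hK k hk n hn1).le
            (hS.nonneg _ (S.sub_mem (hu k) (hu n))) hM.le
      _ = _ := by field_simp
  have h := hlim.sub hdiff
  rw [sub_zero] at h
  refine h.congr fun n => ?_
  rw [sub_sub_cancel, hS.symm _ (hu n) _ (hu n)]

theorem extension_inner_im (hS : IsNonnegSymmetric S) {p : H × H} (hp : p ∈ hS.extension) :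
    (inner ℂ p.1 p.2).im = 0 := by
  obtain ⟨u, hu, hu1, hu2⟩ := hp.2
  have h := (Complex.continuous_im.tendsto _).comp (hS.tendsto_form hp hu hu1 hu2)
  exact tendsto_nhds_unique h (tendsto_const_nhds.congr fun n => (hS.inner_im (hu n)).symm)

/-- Form values on the extension are limits of form values on S, so closing the form keeps its lower
bounds. -/
theorem le_extension_inner (hS : IsNonnegSymmetric S) {m : ℝ}
    (hm : ∀ p ∈ S, m * ‖p.1‖ ^ 2 ≤ (inner ℂ p.1 p.2).re) {p : H × H} (hp : p ∈ hS.extension) :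
    m * ‖p.1‖ ^ 2 ≤ (inner ℂ p.1 p.2).re := by
  obtain ⟨u, hu, hu1, hu2⟩ := hp.2
  have h := (Complex.continuous_re.tendsto _).comp (hS.tendsto_form hp hu hu1 hu2)
  exact le_of_tendsto_of_tendsto' ((hu1.norm.pow 2).const_mul m) h fun n => hm _ (hu n)

/-- Below a lower bound `m` of the form, `A - x` is coercive. -/
theorem norm_le_of_mem_extension (hS : IsNonnegSymmetric S) {m x : ℝ} (hx : x < m)
    (hm : ∀ p ∈ S, m * ‖p.1‖ ^ 2 ≤ (inner ℂ p.1 p.2).re) {p : H × H} (hp : p ∈ hS.extension) :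
    ‖p.1‖ ≤ (m - x)⁻¹ * ‖p.2 - (x : ℂ) • p.1‖ := by
  have hδ : 0 < m - x := sub_pos.mpr hx
  have h1 := hS.le_extension_inner hm hp
  have h2 : (inner ℂ p.1 (p.2 - (x : ℂ) • p.1)).re = (inner ℂ p.1 p.2).re - x * ‖p.1‖ ^ 2 := by
    rw [inner_sub_right, inner_smul_right, inner_self_eq_norm_sq_to_K, Complex.sub_re,
      Complex.re_ofReal_mul]
    norm_cast
  have h3 : (inner ℂ p.1 (p.2 - (x : ℂ) • p.1)).re ≤ ‖p.1‖ * ‖p.2 - (x : ℂ) • p.1‖ :=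
    re_inner_le_norm (𝕜 := ℂ) _ _
  rw [inv_mul_eq_div, le_div_iff₀ hδ]
  rcases (norm_nonneg p.1).eq_or_lt with h0 | h0
  · rw [← h0]; simp
  · refine le_of_mul_le_mul_left ?_ h0
    nlinarith

/-- Below a lower bound `m` of the form, `A - x` is onto: minimise the energy functional. -/
theorem exists_mem_extension [CompleteSpace H] (hS : IsNonnegSymmetric S) {m x : ℝ} (hx : x < m)
    (hm : ∀ p ∈ S, m * ‖p.1‖ ^ 2 ≤ (inner ℂ p.1 p.2).re) (g : H) :
    ∃ ψ : H, (ψ, g + (x : ℂ) • ψ) ∈ hS.extension := by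
  have hδ : 0 < m - x := sub_pos.mpr hx
  set B : H × H → ℝ := fun p => (inner ℂ p.1 p.2).re - x * ‖p.1‖ ^ 2 with hB
  -- The stationarity condition of this functional is the weak form of (A - x)ψ = g.
  set F : H × H → ℝ := fun p => B p - 2 * (inner ℂ p.1 g).re with hF
  have hBpos : ∀ p ∈ S, (m - x) * ‖p.1‖ ^ 2 ≤ B p := fun p hp => by
    have := hm p hp
    simp only [hB]; linarith
  have hexp : ∀ p ∈ S, ∀ q ∈ S, ∀ t : ℝ, F (p + (t : ℂ) • q) =
      F p + 2 * t * (inner ℂ (q.2 - (x : ℂ) • q.1) p.1 - inner ℂ q.1 g).re + t ^ 2 * B q := by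
    intro p hp q hq t
    have h1 := hS.re_inner_add hp hq t
    have h2 : ‖(p + (t : ℂ) • q).1‖ ^ 2 =
        ‖p.1‖ ^ 2 + 2 * t * (inner ℂ q.1 p.1).re + t ^ 2 * ‖q.1‖ ^ 2 := by
      have e1 : (inner ℂ p.1 q.1).re = (inner ℂ q.1 p.1).re := by
        rw [← inner_conj_symm, Complex.conj_re]
      have h := @norm_add_sq ℂ H _ _ _ p.1 ((t : ℂ) • q.1)
      rw [inner_smul_right, norm_smul, mul_pow, Complex.norm_real, Real.norm_eq_abs, sq_abs] at h
      rw [Prod.fst_add, Prod.smul_fst, h]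
      simp [e1]
      ring
    have h3 : (inner ℂ (p + (t : ℂ) • q).1 g).re = (inner ℂ p.1 g).re + t * (inner ℂ q.1 g).re := by
      rw [Prod.fst_add, Prod.smul_fst, inner_add_left, inner_smul_left, Complex.add_re,
        Complex.conj_ofReal, Complex.re_ofReal_mul]
    simp only [hF, hB, h1, h2, h3, inner_sub_left, inner_smul_left, Complex.sub_re,
      Complex.conj_ofReal, Complex.re_ofReal_mul]
    ring
  have hbdd : ∀ p ∈ S, -(‖g‖ ^ 2 / (m - x)) ≤ F p := by
    intro p hp
    have h1 := hBpos p hp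
    have h2 : (inner ℂ p.1 g).re ≤ ‖p.1‖ * ‖g‖ := re_inner_le_norm (𝕜 := ℂ) _ _
    have h3 : 0 ≤ ((m - x) * ‖p.1‖ - ‖g‖) ^ 2 / (m - x) := by positivity
    have h4 : ((m - x) * ‖p.1‖ - ‖g‖) ^ 2 / (m - x) =
        (m - x) * ‖p.1‖ ^ 2 - 2 * (‖p.1‖ * ‖g‖) + ‖g‖ ^ 2 / (m - x) := by
      field_simp
      ring
    simp only [hF]
    linarith
  set I := sInf (F '' S)
  have hbb : BddBelow (F '' S) := ⟨_, by rintro _ ⟨p, hp, rfl⟩; exact hbdd p hp⟩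
  have hIle : ∀ p ∈ S, I ≤ F p := fun p hp => csInf_le hbb ⟨p, hp, rfl⟩
  have hseq : ∀ n : ℕ, ∃ p ∈ S, F p < I + 1 / ((n : ℝ) + 1) := by
    intro n
    have hne : (F '' S).Nonempty := ⟨_, 0, S.zero_mem, rfl⟩
    obtain ⟨_, ⟨p, hp, rfl⟩, h⟩ := exists_lt_of_csInf_lt hne
      (lt_add_of_pos_right I (Nat.one_div_pos_of_nat (α := ℝ) (n := n)))
    exact ⟨p, hp, h⟩
  choose u hu huF using hseq
  have hε : Tendsto (fun n : ℕ => 1 / ((n : ℝ) + 1)) atTop (𝓝 0) :=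
    tendsto_one_div_add_atTop_nhds_zero_nat
  -- Midpoint argument: F is quadratic with leading part B, so B(u n - u k)/2 = F(u n) + F(u k) -
  -- 2F(midpoint), and the midpoint value is at least the infimum.
  have hBdiff : ∀ n k, B (u n - u k) ≤ 2 * (1 / ((n : ℝ) + 1)) + 2 * (1 / ((k : ℝ) + 1)) := by
    intro n k
    have h1 := hexp (u k) (hu k) _ (S.sub_mem (hu n) (hu k)) 1
    have h2 := hexp (u k) (hu k) _ (S.sub_mem (hu n) (hu k)) (1 / 2)
    have h3 := hIle _ (S.add_mem (hu k) (S.smul_mem ((1 / 2 : ℝ) : ℂ) (S.sub_mem (hu n) (hu k))))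
    rw [Complex.ofReal_one, one_smul, add_sub_cancel] at h1
    have h4 := huF n
    have h5 := huF k
    linarith
  have hlim0 : Tendsto (fun k : ℕ × ℕ => 2 * (1 / ((k.1 : ℝ) + 1)) + 2 * (1 / ((k.2 : ℝ) + 1)))
      atTop (𝓝 0) := by
    rw [← prod_atTop_atTop_eq]
    have h1 : Tendsto (fun k : ℕ × ℕ => 1 / ((k.1 : ℝ) + 1)) (atTop ×ˢ atTop) (𝓝 0) :=
      hε.comp tendsto_fst
    have h2 : Tendsto (fun k : ℕ × ℕ => 1 / ((k.2 : ℝ) + 1)) (atTop ×ˢ atTop) (𝓝 0) :=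
      hε.comp tendsto_snd
    simpa using (h1.const_mul 2).add (h2.const_mul 2)
  have hnorm : Tendsto (fun k : ℕ × ℕ => ‖(u k.1).1 - (u k.2).1‖ ^ 2) atTop (𝓝 0) := by
    have h := hlim0.const_mul (m - x)⁻¹
    rw [mul_zero] at h
    refine squeeze_zero (fun k => by positivity) (fun k => ?_) h
    rw [le_inv_mul_iff₀ hδ]
    exact (hBpos _ (S.sub_mem (hu k.1) (hu k.2))).trans (hBdiff _ _)
  have hcau : CauchySeq fun n => (u n).1 := by
    rw [cauchySeq_iff_tendsto_dist_atTop_0]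
    have h := hnorm.sqrt
    simpa [dist_eq_norm] using h
  obtain ⟨ψ, hψ⟩ := cauchySeq_tendsto_of_complete hcau
  have hform : ψ ∈ formDomain (S : Set (H × H)) := by
    refine ⟨u, hu, hψ, ?_⟩
    have h := hlim0.add (hnorm.const_mul x)
    rw [mul_zero, add_zero] at h
    refine squeeze_zero_norm (fun k => ?_) h
    have h1 := hS.norm_inner (S.sub_mem (hu k.1) (hu k.2))
    have h2 := hBdiff k.1 k.2
    simp only [hB, Prod.fst_sub, Prod.snd_sub] at h1 h2 ⊢
    rw [h1]
    linarith
  have hre : ∀ v ∈ S, (inner ℂ (v.2 - (x : ℂ) • v.1) ψ - inner ℂ v.1 g).re = 0 := by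
    intro v hv
    set c := (inner ℂ (v.2 - (x : ℂ) • v.1) ψ - inner ℂ v.1 g).re
    have h : ∀ t : ℝ, 0 ≤ 2 * t * c + t ^ 2 * B v := by
      intro t
      have hl : Tendsto (fun n : ℕ => 1 / ((n : ℝ) + 1) +
          2 * t * (inner ℂ (v.2 - (x : ℂ) • v.1) (u n).1 - inner ℂ v.1 g).re + t ^ 2 * B v)
          atTop (𝓝 (0 + 2 * t * c + t ^ 2 * B v)) := by
        refine (hε.add (Tendsto.const_mul _ ?_)).add tendsto_const_nhds
        exact (Complex.continuous_re.tendsto _).comp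
          ((tendsto_const_nhds.inner hψ).sub tendsto_const_nhds)
      rw [zero_add] at hl
      refine ge_of_tendsto' hl fun n => ?_
      have h1 := hexp (u n) (hu n) v hv t
      have h2 := hIle _ (S.add_mem (hu n) (S.smul_mem (t : ℂ) hv))
      have h3 := huF n
      linarith
    have hBv : 0 ≤ B v := le_trans (by positivity) (hBpos v hv)
    -- Essentially the minimizing t; the denominator is B v + 1 because B v may vanish.
    have h1 := h (-c / (B v + 1))
    have h2 : 2 * (-c / (B v + 1)) * c + (-c / (B v + 1)) ^ 2 * B v =
        -(c ^ 2 * (B v + 2) / (B v + 1) ^ 2) := by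
      field_simp
      ring
    rw [h2] at h1
    by_contra hne
    have : 0 < c ^ 2 * (B v + 2) / (B v + 1) ^ 2 := by positivity
    linarith
  refine ⟨ψ, fun v hv => ?_, hform⟩
  have h1 := hre v hv
  -- Varying in the direction i·v supplies the imaginary part of the weak equation.
  have h2 := hre _ (S.smul_mem Complex.I hv)
  have h3 : inner ℂ (v.2 - (x : ℂ) • v.1) ψ - inner ℂ v.1 g = 0 := by
    refine Complex.ext h1 ?_
    have e : inner ℂ ((Complex.I • v).2 - (x : ℂ) • (Complex.I • v).1) ψ
        - inner ℂ (Complex.I • v).1 g =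
        -Complex.I * (inner ℂ (v.2 - (x : ℂ) • v.1) ψ - inner ℂ v.1 g) := by
      simp only [Prod.smul_fst, Prod.smul_snd, inner_sub_left, inner_smul_left, Complex.conj_I,
        Complex.conj_ofReal]
      ring
    rw [e] at h2
    simpa using h2
  rw [inner_sub_left, inner_smul_left, Complex.conj_ofReal] at h3
  rw [inner_add_right, inner_smul_right]
  linear_combination h3

/-- Minimization gives surjectivity; coercivity gives injectivity and the bound on the inverse. -/
theorem mem_graphResolventSet [CompleteSpace H] (hS : IsNonnegSymmetric S) {m x : ℝ} (hx : x < m)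
    (hm : ∀ p ∈ S, m * ‖p.1‖ ^ 2 ≤ (inner ℂ p.1 p.2).re) :
    (x : ℂ) ∈ graphResolventSet (friedrichs (S : Set (H × H))) := by
  refine ⟨fun g => ?_, _, fun p hp => hS.norm_le_of_mem_extension hx hm hp⟩
  obtain ⟨ψ, hψ⟩ := hS.exists_mem_extension hx hm g
  refine ⟨ψ, hψ, fun φ hφ => ?_⟩
  have h := hS.norm_le_of_mem_extension hx hm (hS.extension.sub_mem hφ hψ)
  simp only [Prod.fst_sub, Prod.snd_sub] at h
  rw [show g + (x : ℂ) • φ - (g + (x : ℂ) • ψ) - (x : ℂ) • (φ - ψ) = 0 by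
    rw [smul_sub]; abel, norm_zero, mul_zero] at h
  exact sub_eq_zero.mp (norm_le_zero_iff.mp h)

theorem bddBelow_spectrum [CompleteSpace H] (hS : IsNonnegSymmetric S) {m : ℝ}
    (hm : ∀ p ∈ S, m * ‖p.1‖ ^ 2 ≤ (inner ℂ p.1 p.2).re) :
    m ∈ lowerBounds {x : ℝ | (x : ℂ) ∉ graphResolventSet (friedrichs (S : Set (H × H)))} :=
  fun _ hx => not_lt.mp fun h => hx (hS.mem_graphResolventSet h hm)

end IsNonnegSymmetric
end Friedrichs
-- Resolvent and variational principle for the bottom of the spectrum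
section Friedrichs

variable {H : Type*} [NormedAddCommGroup H] [InnerProductSpace ℂ H]
variable {S : Submodule ℂ (H × H)}

namespace IsNonnegSymmetric

/-- The resolvent of the Friedrichs extension at `-1`. -/
theorem exists_resolvent [CompleteSpace H] (hS : IsNonnegSymmetric S) :
    ∃ R : H →L[ℂ] H, R.IsPositive ∧ ∀ g ψ, R g = ψ ↔ (ψ, g - ψ) ∈ hS.extension := by
  have hm : ∀ p ∈ S, 0 * ‖p.1‖ ^ 2 ≤ (inner ℂ p.1 p.2).re := fun p hp => by
    rw [zero_mul]; exact hS.nonneg p hp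
  have hx : (-1 : ℝ) < 0 := by norm_num
  have e : ∀ g ψ : H, g + ((-1 : ℝ) : ℂ) • ψ = g - ψ := fun g ψ => by
    rw [Complex.ofReal_neg, Complex.ofReal_one, neg_smul, one_smul, sub_eq_add_neg]
  have hex := (hS.mem_graphResolventSet hx hm).1
  simp only [e] at hex
  choose r hr huniq using hex
  have hmem : ∀ g, (r g, g - r g) ∈ hS.extension := hr
  have hun : ∀ g ψ, (ψ, g - ψ) ∈ hS.extension → ψ = r g := huniq
  let R₀ : H →ₗ[ℂ] H :=
    { toFun := r
      map_add' := fun g g' => by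
        refine (hun _ _ ?_).symm
        have := hS.extension.add_mem (hmem g) (hmem g')
        rwa [Prod.mk_add_mk, sub_add_sub_comm] at this
      map_smul' := fun c g => by
        refine (hun _ _ ?_).symm
        have := hS.extension.smul_mem c (hmem g)
        rwa [Prod.smul_mk, smul_sub] at this }
  have hb : ∀ g, ‖R₀ g‖ ≤ 1 * ‖g‖ := fun g => by
    have := hS.norm_le_of_mem_extension hx hm (hmem g)
    change ‖r g‖ ≤ _
    simpa using this
  refine ⟨R₀.mkContinuous 1 hb, ?_, fun g ψ => ⟨?_, fun h => (hun g ψ h).symm⟩⟩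
  · rw [ContinuousLinearMap.isPositive_iff_complex]
    intro g
    have h1 := hS.extension_inner_im (hmem g)
    have h2 := hS.le_extension_inner hm (hmem g)
    have h3 : (inner ℂ (r g) g : ℂ) = inner ℂ (r g) (g - r g) + ((‖r g‖ ^ 2 : ℝ) : ℂ) := by
      rw [inner_sub_right, inner_self_eq_norm_sq_to_K]
      push_cast
      simp
    have him : (inner ℂ (r g) g).im = 0 := by
      rw [h3, Complex.add_im, h1, Complex.ofReal_im, add_zero]
    have hre : 0 ≤ (inner ℂ (r g) g).re := by
      rw [h3, Complex.add_re, Complex.ofReal_re]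
      rw [zero_mul] at h2
      positivity
    exact ⟨Complex.ext rfl him.symm, hre⟩
  · rintro rfl
    exact hmem g

/-- The Friedrichs extension has spectrum below every Rayleigh quotient. -/
theorem exists_spectrum_le [CompleteSpace H] (hS : IsNonnegSymmetric S) {p : H × H} (hp : p ∈ S)
    (hp0 : p.1 ≠ 0) :
    ∃ x : ℝ, (x : ℂ) ∉ graphResolventSet (friedrichs (S : Set (H × H))) ∧
      x ≤ (inner ℂ p.1 p.2).re / ‖p.1‖ ^ 2 := by
  obtain ⟨R, hR, hRmem⟩ := hS.exists_resolvent
  have : Nontrivial H := ⟨p.1, 0, hp0⟩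
  have hRf : R (p.2 + p.1) = p.1 := (hRmem _ _).mpr (by
    rw [add_sub_cancel_right]; exact hS.le_extension hp)
  have hκ : 0 < ‖R‖ := by
    rw [norm_pos_iff]
    rintro rfl
    exact hp0 hRf.symm
  have hnorm : 0 < ‖p.1‖ := norm_pos_iff.mpr hp0
  have hspec : ‖R‖ ∈ spectrum ℝ R :=
    CStarAlgebra.norm_mem_spectrum_of_nonneg (ContinuousLinearMap.nonneg_iff_isPositive R |>.mpr hR)
  -- Since R = (A + 1)⁻¹ is positive, ‖R‖ lies in its spectrum. The spectral map κ ↦ -1 + κ⁻¹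
  -- carries it to a point of the spectrum of A: an inverse of A - x at that point would produce one
  -- of ‖R‖ - R.
  refine ⟨-1 + ‖R‖⁻¹, fun hres => hspec ?_, ?_⟩
  · have hκ' : (‖R‖ : ℂ) ≠ 0 := by exact_mod_cast hκ.ne'
    have hiff : ∀ g ψ : H, (ψ, g + ((-1 + ‖R‖⁻¹ : ℝ) : ℂ) • ψ) ∈ hS.extension ↔
        R (g + (‖R‖ : ℂ)⁻¹ • ψ) = ψ := fun g ψ => by
      rw [hRmem, Complex.ofReal_add, add_smul]
      simp only [Complex.ofReal_neg, Complex.ofReal_one, neg_smul, one_smul, Complex.ofReal_inv]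
      rw [show g + (-ψ + (‖R‖ : ℂ)⁻¹ • ψ) = g + (‖R‖ : ℂ)⁻¹ • ψ - ψ by abel]
    have hunit : IsUnit (algebraMap ℝ (H →L[ℂ] H) ‖R‖ - R) := by
      rw [ContinuousLinearMap.isUnit_iff_bijective]
      have happ : ∀ g, (algebraMap ℝ (H →L[ℂ] H) ‖R‖ - R) g = (‖R‖ : ℂ) • g - R g := fun g => by
        rw [sub_apply, Algebra.algebraMap_eq_smul_one]
        rfl
      constructor
      · rw [injective_iff_map_eq_zero]
        intro g hg
        rw [happ, sub_eq_zero] at hg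
        obtain ⟨ψ, -, hψ⟩ := hres.1 0
        have h1 : (‖R‖ : ℂ) • g = ψ := hψ _ ((hiff _ _).mpr (by
          rw [zero_add, smul_smul, inv_mul_cancel₀ hκ', one_smul, ← hg]))
        have h2 : (0 : H) = ψ := hψ _ ((hiff _ _).mpr (by simp))
        rw [← h2] at h1
        exact (smul_eq_zero.mp h1).resolve_left hκ'
      · intro f
        obtain ⟨ψ, hψ, -⟩ := hres.1 ((‖R‖ : ℂ)⁻¹ • f)
        have h1 := (hiff _ _).mp hψ
        refine ⟨(‖R‖ : ℂ)⁻¹ • f + (‖R‖ : ℂ)⁻¹ • ψ, ?_⟩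
        rw [happ, h1, smul_add, smul_smul, smul_smul, mul_inv_cancel₀ hκ', one_smul, one_smul,
          add_sub_cancel_right]
    exact hunit
  -- The Cauchy–Schwarz inequality is now applied to the form of R. With f = (A + 1)p.1 and Rf = p.1
  -- it reads ‖p.1‖⁴ ≤ ⟨f, Rf⟩⟨Rf, R Rf⟩ ≤ (q(p) + ‖p.1‖²)·‖R‖‖p.1‖², which is the desired bound on
  -- ‖R‖⁻¹.
  · have hR' : IsNonnegSymmetric (H := H) (R : H →ₗ[ℂ] H).graph :=
      { symm := by
          rintro ⟨a, b⟩ hab ⟨c, d⟩ hcd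
          rw [LinearMap.mem_graph_iff] at hab hcd
          simp only at hab hcd ⊢
          rw [hab, hcd]
          exact hR.inner_left_eq_inner_right a c
        nonneg := by
          rintro ⟨a, b⟩ hab
          rw [LinearMap.mem_graph_iff] at hab
          simp only at hab ⊢
          rw [hab]
          exact hR.re_inner_nonneg_right a }
    set f := p.2 + p.1
    have h1 := hR'.norm_inner_sq_le (p := (f, R f)) (q := (R f, R (R f)))
      (by simp) (by simp)
    simp only [hRf] at h1
    rw [inner_self_eq_norm_sq_to_K] at h1
    have h2 : ‖((‖p.1‖ : ℂ) ^ 2)‖ = ‖p.1‖ ^ 2 := by simp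
    have h3 : (inner ℂ p.1 (R p.1)).re ≤ ‖R‖ * ‖p.1‖ ^ 2 := by
      refine (re_inner_le_norm (𝕜 := ℂ) _ _).trans ?_
      have := R.le_opNorm p.1
      nlinarith
    have h4 : (inner ℂ f p.1).re = (inner ℂ p.1 p.2).re + ‖p.1‖ ^ 2 := by
      rw [inner_add_left, hS.symm p hp p hp, inner_self_eq_norm_sq_to_K, Complex.add_re]
      norm_cast
    change ‖((‖p.1‖ : ℂ) ^ 2)‖ ^ 2 ≤ _ at h1
    rw [h2, h4] at h1
    have h5 := hS.nonneg p hp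
    have h6 : ‖p.1‖ ^ 2 * ‖p.1‖ ^ 2 ≤
        (((inner ℂ p.1 p.2).re + ‖p.1‖ ^ 2) * ‖R‖) * ‖p.1‖ ^ 2 := by
      calc _ = (‖p.1‖ ^ 2) ^ 2 := by ring
        _ ≤ _ := h1
        _ ≤ ((inner ℂ p.1 p.2).re + ‖p.1‖ ^ 2) * (‖R‖ * ‖p.1‖ ^ 2) := by gcongr
        _ = _ := by ring
    have h7 := le_of_mul_le_mul_right h6 (by positivity)
    rw [le_div_iff₀ (by positivity)]
    have h8 : ‖R‖⁻¹ * ‖p.1‖ ^ 2 ≤ (inner ℂ p.1 p.2).re + ‖p.1‖ ^ 2 := by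
      rw [inv_mul_le_iff₀ hκ]
      linarith
    linarith

theorem infSpec_le [CompleteSpace H] (hS : IsNonnegSymmetric S) {p : H × H} (hp : p ∈ S)
    (hp0 : p.1 ≠ 0) :
    infSpec (friedrichs (S : Set (H × H))) ≤ (inner ℂ p.1 p.2).re / ‖p.1‖ ^ 2 := by
  obtain ⟨x, hx, hxle⟩ := hS.exists_spectrum_le hp hp0
  refine (csInf_le ⟨0, hS.bddBelow_spectrum fun p hp => ?_⟩ hx).trans hxle
  rw [zero_mul]
  exact hS.nonneg p hp

/-- If all Rayleigh quotients were at least c, then c would bound the spectrum from below. A nonzero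
vector in the core is required so that the spectrum is nonempty; the infimum of the empty set would
be the default value 0. -/
theorem exists_rayleigh_lt [CompleteSpace H] (hS : IsNonnegSymmetric S)
    (hne : ∃ p ∈ S, p.1 ≠ 0) {c : ℝ} (hc : infSpec (friedrichs (S : Set (H × H))) < c) :
    ∃ p ∈ S, p.1 ≠ 0 ∧ (inner ℂ p.1 p.2).re < c * ‖p.1‖ ^ 2 := by
  by_contra! h
  have hm : ∀ p ∈ S, c * ‖p.1‖ ^ 2 ≤ (inner ℂ p.1 p.2).re := fun p hp => by
    by_cases hp0 : p.1 = 0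
    · simp [hp0]
    · exact h p hp hp0
  obtain ⟨p, hp, hp0⟩ := hne
  obtain ⟨x, hx, -⟩ := hS.exists_spectrum_le hp hp0
  exact absurd (le_csInf ⟨x, hx⟩ (hS.bddBelow_spectrum hm)) hc.not_ge

end IsNonnegSymmetric
end Friedrichs
-- Periodization of compactly supported functions on the line
section Periodization

/-- The `L`-periodization of a function on the line. -/
noncomputable def periodization (χ : ℝ → ℝ) (L t : ℝ) : ℝ := ∑' n : ℤ, χ (t + n * L)

/-- Makes the periodization a finite sum with one index set for all t in a bounded interval, so that
continuity, differentiation and integration can be done term by term. -/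
theorem exists_finset_forall_eq_zero {χ : ℝ → ℝ} (hχ : HasCompactSupport χ) {L : ℝ} (hL : 0 < L)
    (R : ℝ) : ∃ s : Finset ℤ, ∀ t, |t| ≤ R → ∀ n ∉ s, χ (t + n * L) = 0 := by
  obtain ⟨M, hM⟩ := hχ.isCompact.isBounded.exists_norm_le
  obtain ⟨K, hK⟩ := exists_nat_gt ((M + R) / L)
  refine ⟨Finset.Icc (-K) K, fun t ht n hn => ?_⟩
  by_contra h
  have h1 : |t + n * L| ≤ M := hM _ (subset_tsupport _ h)
  apply hn
  rw [Finset.mem_Icc]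
  rw [div_lt_iff₀ hL] at hK
  rw [abs_le] at h1 ht
  constructor
  · have : (-(K : ℝ)) * L ≤ n * L := by linarith
    exact_mod_cast le_of_mul_le_mul_right this hL
  · have : (n : ℝ) * L ≤ K * L := by linarith
    exact_mod_cast le_of_mul_le_mul_right this hL

theorem periodization_eq_sum {χ : ℝ → ℝ} {L t : ℝ} {s : Finset ℤ}
    (hs : ∀ n ∉ s, χ (t + n * L) = 0) : periodization χ L t = ∑ n ∈ s, χ (t + n * L) :=
  tsum_eq_sum hs

theorem continuous_periodization {χ : ℝ → ℝ} (hc : Continuous χ) (hχ : HasCompactSupport χ) {L : ℝ}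
    (hL : 0 < L) : Continuous (periodization χ L) := by
  rw [continuous_iff_continuousAt]
  intro t
  obtain ⟨s, hs⟩ := exists_finset_forall_eq_zero hχ hL (|t| + 1)
  have h : Continuous fun t : ℝ => ∑ n ∈ s, χ (t + n * L) := by fun_prop
  refine h.continuousAt.congr ?_
  filter_upwards [(continuous_abs.tendsto t).eventually_le_const (lt_add_one |t|)] with y hy
  exact (periodization_eq_sum (hs y hy)).symm

theorem hasDerivAt_periodization {χ : ℝ → ℝ} (hd : Differentiable ℝ χ) (hχ : HasCompactSupport χ)
    {L : ℝ} (hL : 0 < L) (t : ℝ) :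
    HasDerivAt (periodization χ L) (periodization (deriv χ) L t) t := by
  obtain ⟨s, hs⟩ := exists_finset_forall_eq_zero hχ hL (|t| + 1)
  obtain ⟨s', hs'⟩ := exists_finset_forall_eq_zero hχ.deriv hL (|t| + 1)
  have h : HasDerivAt (fun t : ℝ => ∑ n ∈ s ∪ s', χ (t + n * L))
      (∑ n ∈ s ∪ s', deriv χ (t + n * L)) t :=
    HasDerivAt.fun_sum fun n _ => (hd _).hasDerivAt.comp_add_const t _
  rw [periodization_eq_sum (s := s ∪ s') fun n hn => hs' t (by linarith) n fun h =>
    hn (Finset.mem_union_right _ h)]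
  refine h.congr_of_eventuallyEq ?_
  filter_upwards [(continuous_abs.tendsto t).eventually_le_const (lt_add_one |t|)] with y hy
  exact periodization_eq_sum fun n hn => hs y hy n fun h => hn (Finset.mem_union_left _ h)

theorem periodization_deriv_eq_zero {χ : ℝ → ℝ} (hd : Differentiable ℝ χ)
    (hχ : HasCompactSupport χ) {L c : ℝ} (hL : 0 < L) (hc : ∀ t, periodization χ L t = c) (t : ℝ) :
    periodization (deriv χ) L t = 0 := by
  have h := hasDerivAt_periodization hd hχ hL t
  rw [funext hc] at h
  exact h.unique (hasDerivAt_const t c)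

theorem periodization_comp_sub {χ : ℝ → ℝ} (L t a : ℝ) :
    periodization (fun s => χ (s - a)) L t = periodization χ L (t - a) :=
  tsum_congr fun n => by rw [sub_add_eq_add_sub]

theorem periodization_periodic (χ : ℝ → ℝ) (L : ℝ) : Function.Periodic (periodization χ L) L :=
  fun t => by
    unfold periodization
    rw [← (Equiv.addRight (1 : ℤ)).tsum_eq (fun n : ℤ => χ (t + n * L))]
    refine tsum_congr fun n => congrArg χ ?_
    simp
    ring

theorem integral_periodization {χ : ℝ → ℝ} (hc : Continuous χ) (hχ : HasCompactSupport χ) {L : ℝ}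
    (hL : 0 < L) : ∫ t in (0)..L, periodization χ L t = ∫ t, χ t := by
  have hint : Integrable χ := hc.integrable_of_hasCompactSupport hχ
  have h1 := hasSum_integral_iUnion (μ := volume) (f := χ)
    (s := fun n : ℤ => Set.Ioc (n * L) ((n + 1) * L)) (fun n => measurableSet_Ioc)
    (by
      have := Set.pairwise_disjoint_Ioc_add_zsmul (0 : ℝ) L
      simpa using this) hint.integrableOn
  have h2 : ⋃ n : ℤ, Set.Ioc ((n : ℝ) * L) ((n + 1) * L) = Set.univ := by
    have := iUnion_Ioc_add_zsmul hL (0 : ℝ)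
    simpa using this
  rw [h2, Measure.restrict_univ] at h1
  rw [← h1.tsum_eq]
  have h3 : ∀ n : ℤ, ∫ t in Set.Ioc ((n : ℝ) * L) ((n + 1) * L), χ t =
      ∫ t in (0)..L, χ (t + n * L) := fun n => by
    rw [intervalIntegral.integral_comp_add_right, intervalIntegral.integral_of_le (by linarith),
      zero_add, add_mul, one_mul, add_comm]
  simp_rw [h3]
  obtain ⟨s, hs⟩ := exists_finset_forall_eq_zero hχ hL L
  have habs : ∀ t ∈ Set.uIcc 0 L, |t| ≤ L := fun t ht => by
    rw [Set.uIcc_of_le hL.le] at ht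
    rw [abs_of_nonneg ht.1]; exact ht.2
  rw [tsum_eq_sum (s := s) fun n hn => ?_]
  · have hi : ∀ n ∈ s, IntervalIntegrable (fun t => χ (t + n * L)) volume 0 L := fun n _ =>
      (hc.comp (by fun_prop : Continuous fun t : ℝ => t + n * L)).intervalIntegrable _ _
    rw [← intervalIntegral.integral_finsetSum hi]
    exact intervalIntegral.integral_congr fun t ht => periodization_eq_sum (hs t (habs t ht))
  · rw [intervalIntegral.integral_congr (g := fun _ => 0) fun t ht => hs t (habs t ht) n hn]
    simp

end Periodization

/-! ### Unfolding integrals over the whole space to a period cell -/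

section Unfolding

variable {ι : Type*}

/-- The cube `[0, L]^ι`. -/
def cube (ι : Type*) (L : ℝ) : Set (EuclideanSpace ℝ ι) := {x | ∀ k, x k ∈ Set.Icc 0 L}

theorem cube_eq_preimage (L : ℝ) :
    cube ι L = (WithLp.ofLp : EuclideanSpace ℝ ι → ι → ℝ) ⁻¹' Set.Icc 0 (fun _ => L) := by
  ext x
  simp only [cube, Set.mem_ofPred_eq, Set.mem_preimage, Set.mem_Icc, Pi.le_def, forall_and]
  rfl

theorem isCompact_cube (L : ℝ) : IsCompact (cube ι L) := by
  rw [cube_eq_preimage]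
  exact (PiLp.homeomorph 2 (fun _ : ι => ℝ)).isCompact_preimage.mpr isCompact_Icc

variable [Fintype ι]

theorem measurableSet_cube (L : ℝ) : MeasurableSet (cube ι L) :=
  (isCompact_cube L).isClosed.measurableSet

/-- The half-open cube, written with floors, has translates that tile space exactly, whereas the
closed cube is compact; they differ by a null set. -/
theorem ae_eq_cube {L : ℝ} (hL : 0 < L) :
    {x : EuclideanSpace ℝ ι | ∀ k, ⌊x k / L⌋ = 0} =ᵐ[volume] cube ι L := by
  have h1 : {x : EuclideanSpace ℝ ι | ∀ k, ⌊x k / L⌋ = 0} =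
      (WithLp.ofLp : EuclideanSpace ℝ ι → ι → ℝ) ⁻¹' Set.univ.pi fun _ => Set.Ico 0 L := by
    ext x
    simp only [Int.floor_eq_zero_iff, Set.mem_preimage, Set.mem_univ_pi, Set.mem_Ico,
      Set.mem_ofPred_eq, le_div_iff₀ hL, div_lt_iff₀ hL, zero_mul, one_mul]
  rw [h1, cube_eq_preimage]
  exact (PiLp.volume_preserving_ofLp ι).quasiMeasurePreserving.preimage_ae_eq
    Measure.univ_pi_Ico_ae_eq_Icc

variable {F : Type*} [NormedAddCommGroup F]

theorem _root_.Continuous.integrableOn_cube {g : EuclideanSpace ℝ ι → F} (hg : Continuous g) {L : ℝ} :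
    IntegrableOn g (cube ι L) :=
  hg.continuousOn.integrableOn_compact (isCompact_cube L)

variable [NormedSpace ℝ F]

/-- The vector `(n_k L)_k`. -/
noncomputable def latticeVec (L : ℝ) (n : ι → ℤ) : EuclideanSpace ℝ ι :=
  WithLp.toLp 2 fun k => (n k : ℝ) * L

/-- The level sets of x ↦ (⌊x k / L⌋)ₖ partition space into translates of one half-open cube. -/
theorem hasSum_integral_cube {L : ℝ} (hL : 0 < L) {g : EuclideanSpace ℝ ι → F}
    (hg : Integrable g) :
    HasSum (fun n : ι → ℤ => ∫ x in cube ι L, g (x + latticeVec L n)) (∫ x, g x) := by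
  set s : (ι → ℤ) → Set (EuclideanSpace ℝ ι) := fun n => {x | ∀ k, ⌊x k / L⌋ = n k} with hs
  have hmeas : ∀ n, MeasurableSet (s n) := fun n => by
    have : s n = ⋂ k, (fun x : EuclideanSpace ℝ ι => ⌊x k / L⌋) ⁻¹' {n k} := by
      ext x; simp [hs]
    rw [this]
    refine MeasurableSet.iInter fun k => ?_
    have hm : Measurable fun x : EuclideanSpace ℝ ι => ⌊x k / L⌋ := by fun_prop
    exact hm (measurableSet_singleton _)
  have hdisj : Pairwise (Function.onFun Disjoint s) := fun n m hnm => by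
    refine Set.disjoint_left.mpr fun x hx hx' => hnm (funext fun k => ?_)
    rw [← hx k, hx' k]
  have hunion : ⋃ n, s n = Set.univ :=
    Set.eq_univ_of_forall fun x => Set.mem_iUnion.mpr ⟨fun k => ⌊x k / L⌋, fun k => rfl⟩
  have h := hasSum_integral_iUnion hmeas hdisj hg.integrableOn
  rw [hunion, Measure.restrict_univ] at h
  convert h using 2 with n
  rw [setIntegral_congr_set (ae_eq_cube hL).symm]
  have hmp := measurePreserving_add_right (volume : Measure (EuclideanSpace ℝ ι)) (latticeVec L n)
  have hpre : (fun x => x + latticeVec L n) ⁻¹' s n =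
      {x : EuclideanSpace ℝ ι | ∀ k, ⌊x k / L⌋ = 0} := by
    ext x
    simp only [hs, latticeVec, Set.mem_preimage, Set.mem_ofPred_eq, PiLp.add_apply, add_div,
      mul_div_cancel_right₀ _ hL.ne', Int.floor_add_intCast, add_eq_right]
  rw [← hpre]
  exact hmp.setIntegral_preimage_emb (measurableEmbedding_addRight _) g (s n)

/-- `x ↦ ∏ₖ χₖ(xₖ)`. -/
noncomputable def prodFun (χ : ι → ℝ → ℝ) (x : EuclideanSpace ℝ ι) : ℝ := ∏ k, χ k (x k)

theorem continuous_prodFun {χ : ι → ℝ → ℝ} (hc : ∀ k, Continuous (χ k)) :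
    Continuous (prodFun χ) :=
  continuous_finsetProd _ fun k _ => (hc k).comp (by fun_prop)

theorem contDiff_prodFun {χ : ι → ℝ → ℝ} {n : WithTop ℕ∞} (hc : ∀ k, ContDiff ℝ n (χ k)) :
    ContDiff ℝ n (prodFun χ) :=
  contDiff_prod fun k _ => (hc k).comp (by fun_prop)

theorem tsupport_prodFun_subset (χ : ι → ℝ → ℝ) :
    tsupport (prodFun χ) ⊆ {x | ∀ k, x k ∈ tsupport (χ k)} := by
  refine closure_minimal (fun x hx k => subset_tsupport _ ?_) ?_
  · exact Finset.prod_ne_zero_iff.mp hx k (Finset.mem_univ k)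
  · have : {x : EuclideanSpace ℝ ι | ∀ k, x k ∈ tsupport (χ k)} =
        ⋂ k, (fun x : EuclideanSpace ℝ ι => x k) ⁻¹' tsupport (χ k) := by ext; simp
    rw [this]
    exact isClosed_iInter fun k => (isClosed_tsupport _).preimage (by fun_prop)

theorem hasCompactSupport_prodFun {χ : ι → ℝ → ℝ} (hχ : ∀ k, HasCompactSupport (χ k)) :
    HasCompactSupport (prodFun χ) := by
  have h : IsCompact ((WithLp.ofLp : EuclideanSpace ℝ ι → ι → ℝ) ⁻¹'
      Set.univ.pi fun k => tsupport (χ k)) :=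
    (PiLp.homeomorph 2 (fun _ : ι => ℝ)).isCompact_preimage.mpr
      (isCompact_univ_pi fun k => (hχ k).isCompact)
  exact h.of_isClosed_subset (isClosed_tsupport _)
    ((tsupport_prodFun_subset χ).trans fun x hx k _ => hx k)

/-- Periodicity with period `L` in every coordinate. -/
def IsPeriodic [DecidableEq ι] {α : Type*} (L : ℝ) (f : EuclideanSpace ℝ ι → α) : Prop :=
  ∀ x k, f (x + EuclideanSpace.single k L) = f x

theorem latticeVec_eq_sum [DecidableEq ι] (L : ℝ) (n : ι → ℤ) :
    latticeVec L n = ∑ k, n k • EuclideanSpace.single k L := by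
  ext j
  simp [latticeVec, Pi.single_apply]

theorem IsPeriodic.add_latticeVec [DecidableEq ι] {α : Type*} {L : ℝ}
    {f : EuclideanSpace ℝ ι → α} (hf : IsPeriodic L f) (x : EuclideanSpace ℝ ι) (n : ι → ℤ) :
    f (x + latticeVec L n) = f x := by
  have h1 : ∀ (k : ι) (m : ℤ) x, f (x + m • EuclideanSpace.single k L) = f x := by
    intro k m
    induction m using Int.induction_on with
    | zero => simp
    | succ m ih => intro x; rw [add_smul, one_smul, ← add_assoc, hf, ih]
    | pred m ih =>
      intro x
      rw [← hf, sub_smul, one_smul, add_assoc, sub_add_cancel, ih]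
  have h2 : ∀ s : Finset ι, ∀ x, f (x + ∑ k ∈ s, n k • EuclideanSpace.single k L) = f x := by
    intro s
    induction s using Finset.induction_on with
    | empty => simp
    | insert k s hk ih => intro x; rw [Finset.sum_insert hk, ← add_assoc, ih, h1]
  rw [latticeVec_eq_sum, h2]

/-- Unfolding: integrating a periodic function against a product of cutoffs. -/
theorem integral_prodFun_smul [DecidableEq ι] {L : ℝ} (hL : 0 < L) {χ : ι → ℝ → ℝ}
    (hc : ∀ k, Continuous (χ k)) (hχ : ∀ k, HasCompactSupport (χ k))
    {f : EuclideanSpace ℝ ι → F} (hfc : Continuous f) (hf : IsPeriodic L f) :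
    ∫ x, prodFun χ x • f x = ∫ x in cube ι L, prodFun (fun k => periodization (χ k) L) x • f x := by
  have hint : Integrable fun x => prodFun χ x • f x :=
    ((continuous_prodFun hc).smul hfc).integrable_of_hasCompactSupport
      (hasCompactSupport_prodFun hχ).smul_right
  rw [← (hasSum_integral_cube hL hint).tsum_eq]
  choose s hs using fun k => exists_finset_forall_eq_zero (hχ k) hL L
  have habs : ∀ x ∈ cube ι L, ∀ k, |x k| ≤ L := fun x hx k => by
    rw [abs_of_nonneg (hx k).1]; exact (hx k).2
  simp_rw [hf.add_latticeVec]
  -- Only lattice points in a finite product of index sets contribute on the cube, and over such a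
  -- product the sum of products factors into a product of sums, coordinate by coordinate.
  rw [tsum_eq_sum (s := Fintype.piFinset s) fun n hn => ?_]
  · rw [← integral_finsetSum _ fun n _ => ?_]
    · refine setIntegral_congr_fun (measurableSet_cube L) fun x hx => ?_
      rw [← Finset.sum_smul]
      congr 1
      simp only [prodFun]
      rw [Finset.prod_congr rfl fun k _ => periodization_eq_sum (hs k _ (habs x hx k)),
        Finset.prod_univ_sum]
      simp [latticeVec]
    · refine Continuous.integrableOn_cube ?_
      exact ((continuous_prodFun hc).comp (continuous_id.add continuous_const)).smul hfc
  · rw [Fintype.mem_piFinset, not_forall] at hn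
    obtain ⟨k, hk⟩ := hn
    refine setIntegral_eq_zero_of_forall_eq_zero fun x hx => ?_
    have : prodFun χ (x + latticeVec L n) = 0 :=
      Finset.prod_eq_zero (Finset.mem_univ k) (hs k _ (habs x hx k) _ hk)
    rw [this, zero_smul]

theorem prodFun_mul (χ χ' : ι → ℝ → ℝ) (x : EuclideanSpace ℝ ι) :
    prodFun χ x * prodFun χ' x = prodFun (fun k t => χ k t * χ' k t) x :=
  Finset.prod_mul_distrib.symm

theorem prodFun_one_update (χ : ι → ℝ → ℝ) (x : EuclideanSpace ℝ ι) (k : ι)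
    (h : ∀ j ≠ k, χ j (x j) = 1) : prodFun χ x = χ k (x k) :=
  Finset.prod_eq_single k (fun j _ hj => h j hj) fun h => absurd (Finset.mem_univ k) h

theorem integral_cube_eq_integral {L : ℝ} {f : EuclideanSpace ℝ ι → F}
    (hf : tsupport f ⊆ cube ι L) : ∫ x in cube ι L, f x = ∫ x, f x :=
  setIntegral_eq_integral_of_forall_compl_eq_zero fun x hx => by
    by_contra h
    exact hx (hf (subset_tsupport _ h))

end Unfolding
-- The one-dimensional cutoff and its localization error
section Cutoff

/-- A smooth function rising from `0` to `1` on `[-1/2, 1/2]`, with `f(s)² + f(-s)² = 1`. -/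
noncomputable def smoothStep (s : ℝ) : ℝ :=
  Real.sin (Real.pi / 2 * Real.smoothTransition (s + 1 / 2))

theorem contDiff_smoothStep {n : ℕ∞} : ContDiff ℝ n smoothStep :=
  Real.contDiff_sin.comp (contDiff_const.mul
    (Real.smoothTransition.contDiff.comp (contDiff_id.add contDiff_const)))

theorem smoothStep_of_le {s : ℝ} (hs : s ≤ -(1 / 2)) : smoothStep s = 0 := by
  rw [smoothStep, Real.smoothTransition.zero_of_nonpos (by linarith)]
  simp

theorem smoothStep_of_ge {s : ℝ} (hs : 1 / 2 ≤ s) : smoothStep s = 1 := by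
  rw [smoothStep, Real.smoothTransition.one_of_one_le (by linarith)]
  simp

/-- The smooth transition θ satisfies θ(1 - u) = 1 - θ(u), so reflection turns the sine into the
cosine of the same angle. -/
theorem smoothStep_sq_add (s : ℝ) : smoothStep s ^ 2 + smoothStep (-s) ^ 2 = 1 := by
  have h : Real.smoothTransition (-s + 1 / 2) = 1 - Real.smoothTransition (s + 1 / 2) := by
    have := (Real.smoothTransition.pos_denom (s + 1 / 2)).ne'
    unfold Real.smoothTransition
    rw [show 1 - (-s + 1 / 2) = s + 1 / 2 by ring, show 1 - (s + 1 / 2) = -s + 1 / 2 by ring] at *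
    rw [add_comm (expNegInvGlue (-s + 1 / 2)), eq_sub_iff_add_eq, ← add_div,
      add_comm (expNegInvGlue (-s + 1 / 2)), div_self this]
  rw [smoothStep, smoothStep, h, mul_sub, mul_one, Real.sin_pi_div_two_sub]
  exact Real.sin_sq_add_cos_sq _

theorem abs_smoothStep_le_one (s : ℝ) : |smoothStep s| ≤ 1 := Real.abs_sin_le_one _

theorem hasCompactSupport_deriv_smoothStep : HasCompactSupport (deriv smoothStep) := by
  refine HasCompactSupport.intro' (K := Set.Icc (-(1 / 2)) (1 / 2)) isCompact_Icc isClosed_Icc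
    fun s hs => ?_
  rw [Set.mem_Icc, not_and_or, not_le, not_le] at hs
  rcases hs with hs | hs
  · have h : smoothStep =ᶠ[𝓝 s] fun _ => 0 := by
      filter_upwards [gt_mem_nhds hs] with y hy using smoothStep_of_le hy.le
    rw [h.deriv_eq, deriv_const]
  · have h : smoothStep =ᶠ[𝓝 s] fun _ => 1 := by
      filter_upwards [lt_mem_nhds hs] with y hy using smoothStep_of_ge hy.le
    rw [h.deriv_eq, deriv_const]

/-- A smooth cutoff to `(0, L + 2ℓ)`, equal to `1` on `[3ℓ/2, L + ℓ/2]`. -/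
noncomputable def cutoff (L ℓ t : ℝ) : ℝ := smoothStep (t / ℓ - 1) * smoothStep ((L - t) / ℓ + 1)

variable {L ℓ : ℝ}

theorem contDiff_cutoff {n : ℕ∞} : ContDiff ℝ n (cutoff L ℓ) :=
  (contDiff_smoothStep.comp ((contDiff_id.div_const _).sub contDiff_const)).mul
    (contDiff_smoothStep.comp (((contDiff_const.sub contDiff_id).div_const _).add contDiff_const))

theorem cutoff_of_le (hℓ : 0 < ℓ) {t : ℝ} (ht : t ≤ ℓ / 2) : cutoff L ℓ t = 0 := by
  rw [cutoff, smoothStep_of_le, zero_mul]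
  rw [sub_le_iff_le_add, div_le_iff₀ hℓ]
  linarith

theorem cutoff_of_ge (hℓ : 0 < ℓ) {t : ℝ} (ht : L + 3 * ℓ / 2 ≤ t) : cutoff L ℓ t = 0 := by
  rw [cutoff, smoothStep_of_le (s := (L - t) / ℓ + 1), mul_zero]
  rw [← le_sub_iff_add_le, div_le_iff₀ hℓ]
  linarith

theorem tsupport_cutoff_subset (hℓ : 0 < ℓ) : tsupport (cutoff L ℓ) ⊆ Set.Ioo 0 (L + 2 * ℓ) := by
  have h : tsupport (cutoff L ℓ) ⊆ Set.Icc (ℓ / 2) (L + 3 * ℓ / 2) := by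
    refine closure_minimal (fun t ht => ?_) isClosed_Icc
    by_contra h
    rw [Set.mem_Icc, not_and_or, not_le, not_le] at h
    exact ht (h.elim (fun h => cutoff_of_le hℓ h.le) fun h => cutoff_of_ge hℓ h.le)
  refine h.trans fun t ht => ⟨?_, ?_⟩
  · linarith [ht.1]
  · linarith [ht.2]

theorem hasCompactSupport_cutoff (hℓ : 0 < ℓ) : HasCompactSupport (cutoff L ℓ) :=
  isCompact_Icc.of_isClosed_subset (isClosed_tsupport _)
    ((tsupport_cutoff_subset hℓ).trans Set.Ioo_subset_Icc_self)

/-- Writes q² as the difference of a step and its translate by L, so that the periodization of q²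
telescopes. Because ℓ ≤ L, the rising step has already reached 1 where the falling one starts. -/
theorem cutoff_sq (hℓ : 0 < ℓ) (hL : ℓ ≤ L) (t : ℝ) :
    cutoff L ℓ t ^ 2 = smoothStep (t / ℓ - 1) ^ 2 - smoothStep ((t - L) / ℓ - 1) ^ 2 := by
  have h1 := smoothStep_sq_add ((t - L) / ℓ - 1)
  rw [show -((t - L) / ℓ - 1) = (L - t) / ℓ + 1 by ring] at h1
  rw [cutoff, mul_pow, eq_sub_of_add_eq' h1]
  by_cases h : (t - L) / ℓ - 1 ≤ -(1 / 2)
  · rw [smoothStep_of_le h]; ring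
  · have h2 : 1 ≤ L / ℓ := (one_le_div hℓ).mpr hL
    rw [sub_div] at h
    rw [smoothStep_of_ge (s := t / ℓ - 1) (by linarith)]; ring

theorem periodization_cutoff_sq (hℓ : 0 < ℓ) (hL : ℓ ≤ L) (t : ℝ) :
    periodization (fun s => cutoff L ℓ s ^ 2) L t = 1 := by
  have hL0 : 0 < L := hℓ.trans_le hL
  -- On the period [ℓ/2, ℓ/2 + L) only the translates n = 0 and n = 1 can be nonzero.
  obtain ⟨y, hy, hty⟩ := (periodization_periodic (fun s => cutoff L ℓ s ^ 2) L).exists_mem_Ico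
    hL0 t (ℓ / 2)
  rw [hty, periodization_eq_sum (s := {0, 1})]
  · have hLℓ : 1 ≤ L / ℓ := (one_le_div hℓ).mpr hL
    have h1 : (y - L) / ℓ - 1 ≤ -(1 / 2) := by
      rw [sub_le_iff_le_add, div_le_iff₀ hℓ]
      linarith [hy.2]
    have h2 : 1 / 2 ≤ (y + L) / ℓ - 1 := by
      rw [le_sub_iff_add_le, le_div_iff₀ hℓ]
      linarith [hy.1]
    rw [Finset.sum_pair zero_ne_one, Int.cast_zero, Int.cast_one, zero_mul, one_mul, add_zero,
      cutoff_sq hℓ hL, cutoff_sq hℓ hL, add_sub_cancel_right, smoothStep_of_le h1,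
      smoothStep_of_ge h2]
    ring
  · intro n hn
    simp only [Finset.mem_insert, Finset.mem_singleton, not_or] at hn
    have : n ≤ -1 ∨ 2 ≤ n := by omega
    rcases this with h | h
    · have h' : (n : ℝ) ≤ -1 := by exact_mod_cast h
      rw [cutoff_of_le hℓ, zero_pow two_ne_zero]
      nlinarith [hy.2]
    · have h' : (2 : ℝ) ≤ n := by exact_mod_cast h
      rw [cutoff_of_ge hℓ, zero_pow two_ne_zero]
      nlinarith [hy.1]

theorem abs_cutoff_le_one (t : ℝ) : |cutoff L ℓ t| ≤ 1 := by
  rw [cutoff, abs_mul]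
  exact mul_le_one₀ (abs_smoothStep_le_one _) (abs_nonneg _) (abs_smoothStep_le_one _)

theorem deriv_deriv_cutoff (t : ℝ) :
    deriv (deriv (cutoff L ℓ)) t = (ℓ⁻¹) ^ 2 *
      (deriv (deriv smoothStep) (t / ℓ - 1) * smoothStep ((L - t) / ℓ + 1) -
        2 * (deriv smoothStep (t / ℓ - 1) * deriv smoothStep ((L - t) / ℓ + 1)) +
        smoothStep (t / ℓ - 1) * deriv (deriv smoothStep) ((L - t) / ℓ + 1)) := by
  have hd : ∀ s, HasDerivAt smoothStep (deriv smoothStep s) s := fun s =>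
    ((contDiff_smoothStep (n := 1)).differentiable (by simp) s).hasDerivAt
  have hdd : ∀ s, HasDerivAt (deriv smoothStep) (deriv (deriv smoothStep) s) s := fun s =>
    (((contDiff_smoothStep (n := 2)).iterate_deriv' 1 1).differentiable (by simp) s).hasDerivAt
  have ha : ∀ t : ℝ, HasDerivAt (fun t => t / ℓ - 1) ℓ⁻¹ t := fun t => by
    simpa using ((hasDerivAt_id t).div_const ℓ).sub_const 1
  have hb : ∀ t : ℝ, HasDerivAt (fun t => (L - t) / ℓ + 1) (-ℓ⁻¹) t := fun t => by
    simpa [neg_div] using (((hasDerivAt_id t).const_sub L).div_const ℓ).add_const 1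
  have h1 : deriv (cutoff L ℓ) = fun t =>
      (deriv smoothStep (t / ℓ - 1) * ℓ⁻¹) * smoothStep ((L - t) / ℓ + 1) +
        smoothStep (t / ℓ - 1) * (deriv smoothStep ((L - t) / ℓ + 1) * -ℓ⁻¹) := funext fun t =>
    (((hd _).comp t (ha t)).mul ((hd _).comp t (hb t))).deriv
  rw [h1]
  refine (HasDerivAt.congr_deriv
    (((((hdd _).comp t (ha t)).mul_const ℓ⁻¹).mul ((hd _).comp t (hb t))).add
    (((hd _).comp t (ha t)).mul (((hdd _).comp t (hb t)).mul_const (-ℓ⁻¹)))) ?_).deriv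
  simp only [Function.comp]
  ring

/-- The second derivative is of size ℓ⁻² and lives on two transition layers of width of order ℓ. It
suffices to bound -qq'' by |q''|; the point is that C depends on neither L nor ℓ. -/
theorem exists_integral_cutoff_le : ∃ C : ℝ, 0 ≤ C ∧ ∀ L ℓ : ℝ, 0 < ℓ →
    ∫ t, -(cutoff L ℓ t * deriv (deriv (cutoff L ℓ)) t) ≤ C / ℓ := by
  set f₁ := deriv smoothStep
  set f₂ := deriv f₁
  have hc₁ : Continuous f₁ := (contDiff_smoothStep (n := 1)).continuous_deriv (by simp)
  have hc₂ : Continuous f₂ := by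
    have := ((contDiff_smoothStep (n := 2)).iterate_deriv' 0 2).continuous
    exact this
  have hs₁ : HasCompactSupport f₁ := hasCompactSupport_deriv_smoothStep
  have hs₂ : HasCompactSupport f₂ := hs₁.deriv
  obtain ⟨K, hK⟩ := hs₁.exists_bound_of_continuous hc₁
  have hK0 : 0 ≤ K := (norm_nonneg _).trans (hK 0)
  have hi₁ : Integrable fun s => |f₁ s| := (hc₁.integrable_of_hasCompactSupport hs₁).abs
  have hi₂ : Integrable fun s => |f₂ s| := (hc₂.integrable_of_hasCompactSupport hs₂).abs
  refine ⟨(∫ s, |f₂ s|) + 2 * K * (∫ s, |f₁ s|) + ∫ s, |f₂ s|, by positivity,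
    fun L ℓ hℓ => ?_⟩
  -- A majorant of |q''|: undifferentiated steps are bounded by 1, and in the cross term one first
  -- derivative is bounded by K.
  set G : ℝ → ℝ := fun t => (ℓ⁻¹) ^ 2 *
    (|f₂ (t / ℓ - 1)| + 2 * K * |f₁ (t / ℓ - 1)| + |f₂ ((L - t) / ℓ + 1)|) with hG
  have hl : ∀ g : ℝ → ℝ, Integrable g → Integrable (fun t => g (t / ℓ - 1)) ∧
      ∫ t, g (t / ℓ - 1) = ℓ * ∫ t, g t := by
    intro g hg
    refine ⟨(hg.comp_sub_right 1).comp_div hℓ.ne', ?_⟩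
    rw [Measure.integral_comp_div (fun s => g (s - 1)), integral_sub_right_eq_self, smul_eq_mul,
      abs_of_pos hℓ]
  have hr : ∀ g : ℝ → ℝ, Integrable g → Integrable (fun t => g ((L - t) / ℓ + 1)) ∧
      ∫ t, g ((L - t) / ℓ + 1) = ℓ * ∫ t, g t := by
    intro g hg
    have e : ∀ t, g ((L - t) / ℓ + 1) = (fun s => g (L / ℓ + 1 - s)) (t / ℓ) := fun t => by
      simp only; congr 1; ring
    simp_rw [e]
    refine ⟨(hg.comp_sub_left (L / ℓ + 1)).comp_div hℓ.ne', ?_⟩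
    rw [Measure.integral_comp_div (fun s => g (L / ℓ + 1 - s)), integral_sub_left_eq_self,
      smul_eq_mul, abs_of_pos hℓ]
  have h2 := hl _ hi₂
  have h1 := hl _ hi₁
  have h3 := hr _ hi₂
  have h12 : Integrable fun t => |f₂ (t / ℓ - 1)| + 2 * K * |f₁ (t / ℓ - 1)| :=
    h2.1.add (h1.1.const_mul (2 * K))
  have hGi : Integrable G := (h12.add h3.1).const_mul _
  have hGe : ∫ t, G t = ((∫ s, |f₂ s|) + 2 * K * (∫ s, |f₁ s|) + ∫ s, |f₂ s|) / ℓ := by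
    rw [hG, integral_const_mul, integral_add h12 h3.1,
      integral_add h2.1 (h1.1.const_mul (2 * K)), integral_const_mul, h1.2, h2.2, h3.2]
    field_simp
  rw [← hGe]
  have hqi : Integrable fun t => -(cutoff L ℓ t * deriv (deriv (cutoff L ℓ)) t) := by
    have h := contDiff_cutoff (L := L) (ℓ := ℓ) (n := 2)
    exact ((h.continuous.mul (h.iterate_deriv' 0 2).continuous).integrable_of_hasCompactSupport
      (hasCompactSupport_cutoff hℓ).mul_right).neg
  refine integral_mono hqi hGi fun t => (neg_le_abs _).trans ?_
  rw [abs_mul]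
  refine (mul_le_of_le_one_left (abs_nonneg _) (abs_cutoff_le_one t)).trans ?_
  rw [deriv_deriv_cutoff, abs_mul, abs_of_nonneg (by positivity : 0 ≤ ℓ⁻¹ ^ 2)]
  refine mul_le_mul_of_nonneg_left ?_ (by positivity)
  refine (abs_add_le _ _).trans (add_le_add ((abs_sub _ _).trans (add_le_add ?_ ?_)) ?_)
  · rw [abs_mul]
    exact mul_le_of_le_one_right (abs_nonneg _) (abs_smoothStep_le_one _)
  · rw [abs_mul, abs_mul, abs_two, mul_assoc, mul_comm K]
    exact mul_le_mul_of_nonneg_left (mul_le_mul_of_nonneg_left (hK _) (abs_nonneg _)) two_pos.le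
  · rw [abs_mul]
    exact mul_le_of_le_one_left (abs_nonneg _) (abs_smoothStep_le_one _)

end Cutoff
-- Partial derivatives and integration by parts without boundary terms
section PartialDerivatives

variable {ι : Type*} [DecidableEq ι] {F : Type*} [NormedAddCommGroup F] [NormedSpace ℝ F]

/-- The partial derivative in the direction of the coordinate `k`. -/
noncomputable def pd (k : ι) (f : EuclideanSpace ℝ ι → F) (x : EuclideanSpace ℝ ι) : F :=
  fderiv ℝ f x (EuclideanSpace.single k 1)

theorem tsupport_pd_subset (k : ι) (f : EuclideanSpace ℝ ι → F) : tsupport (pd k f) ⊆ tsupport f :=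
  closure_minimal (fun x hx => by
    by_contra h
    apply hx
    have : fderiv ℝ f x = 0 := by
      by_contra h'
      exact h (tsupport_fderiv_subset ℝ (subset_tsupport _ h'))
    rw [pd, this]; rfl) (isClosed_tsupport f)

variable [Fintype ι]

theorem _root_.ContDiff.pd {n : WithTop ℕ∞} {f : EuclideanSpace ℝ ι → F} (hf : ContDiff ℝ (n + 1) f)
    (k : ι) : ContDiff ℝ n (pd k f) :=
  (hf.fderiv_right le_rfl).clm_apply contDiff_const

theorem laplacian_eq_sum_pd {f : EuclideanSpace ℝ ι → F} (hf : ContDiff ℝ 2 f)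
    (x : EuclideanSpace ℝ ι) : (Δ f) x = ∑ k, pd k (pd k f) x := by
  rw [InnerProductSpace.laplacian_eq_iteratedFDeriv_orthonormalBasis f
    (EuclideanSpace.basisFun ι ℝ)]
  refine Finset.sum_congr rfl fun k _ => ?_
  have hd : DifferentiableAt ℝ (fderiv ℝ f) x :=
    (hf.fderiv_right (m := 1) (by norm_num)).differentiable (by simp) x
  rw [iteratedFDeriv_two_apply]
  unfold pd
  rw [fderiv_clm_apply hd (differentiableAt_const _)]
  simp

theorem pd_smul {c : EuclideanSpace ℝ ι → ℝ} {f : EuclideanSpace ℝ ι → F} (hc : Differentiable ℝ c)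
    (hf : Differentiable ℝ f) (k : ι) :
    pd k (fun x => c x • f x) = fun x => c x • pd k f x + pd k c x • f x := funext fun x => by
  unfold pd
  rw [fderiv_fun_smul (hc x) (hf x)]
  simp

theorem pd_mul {f g : EuclideanSpace ℝ ι → ℂ} (hf : Differentiable ℝ f)
    (hg : Differentiable ℝ g) (k : ι) :
    pd k (fun x => f x * g x) = fun x => f x * pd k g x + pd k f x * g x := funext fun x => by
  unfold pd
  rw [fderiv_fun_mul (hf x) (hg x)]
  simp [mul_comm]

theorem pd_add {f g : EuclideanSpace ℝ ι → F} (hf : Differentiable ℝ f)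
    (hg : Differentiable ℝ g) (k : ι) :
    pd k (fun x => f x + g x) = fun x => pd k f x + pd k g x := funext fun x => by
  unfold pd
  rw [fderiv_fun_add (hf x) (hg x)]
  rfl

theorem pd_conj {f : EuclideanSpace ℝ ι → ℂ} (hf : Differentiable ℝ f) (k : ι) :
    pd k (fun x => starRingEnd ℂ (f x)) = fun x => starRingEnd ℂ (pd k f x) := funext fun x => by
  have h := ((Complex.conjCLE : ℂ →L[ℝ] ℂ).hasFDerivAt.comp x (hf x).hasFDerivAt).fderiv
  unfold pd
  change fderiv ℝ (⇑(Complex.conjCLE : ℂ →L[ℝ] ℂ) ∘ f) x _ = _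
  rw [h]
  rfl

theorem pd_comp_add (f : EuclideanSpace ℝ ι → F) (k : ι) (a : EuclideanSpace ℝ ι) :
    pd k (fun x => f (x + a)) = fun x => pd k f (x + a) := funext fun x => by
  unfold pd
  rw [fderiv_comp_add_right]

theorem IsPeriodic.pd {L : ℝ} {f : EuclideanSpace ℝ ι → F} (hf : IsPeriodic L f) (k : ι) :
    IsPeriodic L (pd k f) := fun x j => by
  have h := congrFun (pd_comp_add f k (EuclideanSpace.single j L)) x
  rw [← h]
  congr 1
  exact funext fun y => hf y j

theorem pd_prodFun {χ : ι → ℝ → ℝ} (hχ : ∀ k, Differentiable ℝ (χ k)) (k : ι) :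
    pd k (prodFun χ) = prodFun (Function.update χ k (deriv (χ k))) := funext fun x => by
  have h : ∀ j ∈ Finset.univ, HasFDerivAt (fun x : EuclideanSpace ℝ ι => χ j (x j))
      (deriv (χ j) (x j) • EuclideanSpace.proj (𝕜 := ℝ) j) x := fun j _ =>
    (hχ j (x j)).hasDerivAt.comp_hasFDerivAt x (EuclideanSpace.proj (𝕜 := ℝ) j).hasFDerivAt
  have h2 := HasFDerivAt.finsetProd h
  unfold pd
  have e : prodFun χ = fun x : EuclideanSpace ℝ ι => ∏ j, χ j (x j) := rfl
  rw [e, h2.fderiv, sum_apply, Finset.sum_eq_single k]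
  · rw [prodFun, ← Finset.mul_prod_erase _ _ (Finset.mem_univ k)]
    simp only [smul_apply, PiLp.proj_apply, PiLp.single_eq_same, smul_eq_mul, mul_one,
      Function.update_self]
    rw [mul_comm]
    congr 1
    exact Finset.prod_congr rfl fun j hj => by rw [Function.update_of_ne (Finset.ne_of_mem_erase hj)]
  · intro j _ hj
    simp [hj]
  · simp

/-- The integral of a partial derivative of a periodic function over a period vanishes. -/
theorem integral_cube_pd_of_periodic {L : ℝ} (hL : 0 < L) {f : EuclideanSpace ℝ ι → ℂ}
    (hf : ContDiff ℝ 1 f) (hp : IsPeriodic L f) (k : ι) : ∫ x in cube ι L, pd k f x = 0 := by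
  -- A partition of unity in each coordinate moves the integral to the whole space. Integration by
  -- parts there puts the derivative on χ, and the periodization of χ' is zero because that of χ is
  -- constant.
  set χ : ℝ → ℝ := fun t => cutoff L L t ^ 2
  have hχ : ContDiff ℝ 2 χ := (contDiff_cutoff (n := 2)).pow 2
  have hχs : HasCompactSupport χ := by
    refine (hasCompactSupport_cutoff (L := L) hL).comp_left (g := fun y => y ^ 2) (by simp)
  have hχd : Differentiable ℝ χ := hχ.differentiable (by simp)
  have hχp : ∀ t, periodization χ L t = 1 := periodization_cutoff_sq hL le_rfl
  have hχp' : ∀ t, periodization (deriv χ) L t = 0 :=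
    periodization_deriv_eq_zero hχd hχs hL hχp
  have hcd : Continuous (deriv χ) := hχ.continuous_deriv (by simp)
  have hc' : ∀ j, Continuous (Function.update (fun _ : ι => χ) k (deriv χ) j) := fun j => by
    rcases eq_or_ne j k with rfl | h
    · rw [Function.update_self]; exact hcd
    · rw [Function.update_of_ne h]; exact hχ.continuous
  have hs' : ∀ j, HasCompactSupport (Function.update (fun _ : ι => χ) k (deriv χ) j) := fun j => by
    rcases eq_or_ne j k with rfl | h
    · rw [Function.update_self]; exact hχs.deriv
    · rw [Function.update_of_ne h]; exact hχs
  have hpd := pd_prodFun (fun _ : ι => hχd) k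
  have hpdc : Continuous (pd k f) := (hf.pd (n := 0) k).continuous
  have hs : HasCompactSupport (prodFun fun _ : ι => χ) := hasCompactSupport_prodFun fun _ => hχs
  have hcont : Continuous (prodFun fun _ : ι => χ) := continuous_prodFun fun _ => hχ.continuous
  have h1 := integral_prodFun_smul hL (fun _ : ι => hχ.continuous) (fun _ => hχs) hpdc (hp.pd k)
  have h2 := integral_prodFun_smul hL hc' hs' hf.continuous hp
  have h3 : ∫ x, prodFun (fun _ : ι => χ) x • pd k f x =
      -∫ x, pd k (prodFun fun _ : ι => χ) x • f x := by
    refine integral_smul_fderiv_eq_neg_fderiv_smul_of_integrable ?_ ?_ ?_ ?_ ?_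
    · change Integrable fun x => pd k (prodFun fun _ : ι => χ) x • f x
      rw [hpd]
      exact ((continuous_prodFun hc').smul hf.continuous).integrable_of_hasCompactSupport
        (hasCompactSupport_prodFun hs').smul_right
    · exact (hcont.smul hpdc).integrable_of_hasCompactSupport hs.smul_right
    · exact (hcont.smul hf.continuous).integrable_of_hasCompactSupport hs.smul_right
    · exact fun x _ => (contDiff_prodFun (n := 1) fun _ => hχ.of_le (by norm_num)).differentiable
        (by simp) x
    · exact fun x _ => hf.differentiable (by simp) x
  rw [hpd, h1, h2] at h3
  simp only [funext hχp] at h3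
  have h4 : ∀ x : EuclideanSpace ℝ ι,
      prodFun (fun j => periodization (Function.update (fun _ : ι => χ) k (deriv χ) j) L) x = 0 :=
    fun x => Finset.prod_eq_zero (Finset.mem_univ k) (by simp only [Function.update_self, hχp'])
  simp_rw [h4] at h3
  simpa [prodFun] using h3

theorem integral_cube_pd_of_tsupport {L : ℝ} {f : EuclideanSpace ℝ ι → ℂ}
    (hf : ContDiff ℝ 1 f) (hs : tsupport f ⊆ cube ι L) (k : ι) : ∫ x in cube ι L, pd k f x = 0 := by
  have hcs : HasCompactSupport f := (isCompact_cube L).of_isClosed_subset (isClosed_tsupport f) hs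
  have hcs' : HasCompactSupport (pd k f) :=
    (isCompact_cube L).of_isClosed_subset (isClosed_tsupport _) ((tsupport_pd_subset k f).trans hs)
  rw [integral_cube_eq_integral ((tsupport_pd_subset k f).trans hs)]
  have hc : Continuous (pd k f) := (hf.pd (n := 0) k).continuous
  have h := integral_smul_fderiv_eq_neg_fderiv_smul_of_integrable (𝕜 := ℝ) (μ := volume)
    (f := fun _ : EuclideanSpace ℝ ι => (1 : ℝ)) (g := f) (v := EuclideanSpace.single k 1)
    (by simp) ((hc.integrable_of_hasCompactSupport hcs').congr (ae_of_all _ fun x => (one_smul ℝ _).symm))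
    (by simpa using hf.continuous.integrable_of_hasCompactSupport hcs)
    (by fun_prop) (fun x _ => hf.differentiable (by simp) x)
  simp only [one_smul, fderiv_fun_const, Pi.zero_apply, zero_apply, zero_smul, integral_zero, neg_zero] at h
  exact h

end PartialDerivatives
-- Kinetic energy of a localized periodic function
section Localization

variable {ι : Type*} [Fintype ι] [DecidableEq ι] {F : Type*} [NormedAddCommGroup F]
  [NormedSpace ℝ F]

theorem prodFun_mul_update (q s : ℝ → ℝ) (k : ι) (x : EuclideanSpace ℝ ι) :
    prodFun (fun _ => q) x * prodFun (Function.update (fun _ => q) k s) x =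
      prodFun (Function.update (fun _ t => q t * q t) k fun t => q t * s t) x := by
  rw [prodFun_mul]
  refine Finset.prod_congr rfl fun j _ => ?_
  rcases eq_or_ne j k with rfl | h
  · simp
  · simp [h]

/-- Unfolding with a partition of unity in all coordinates but one. -/
theorem integral_prodFun_update_smul {L : ℝ} (hL : 0 < L) {p r : ℝ → ℝ}
    (hp : Continuous p) (hps : HasCompactSupport p) (hr : Continuous r) (hrs : HasCompactSupport r)
    (hp1 : ∀ t, periodization p L t = 1) (k : ι) {f : EuclideanSpace ℝ ι → F} (hfc : Continuous f)
    (hf : IsPeriodic L f) :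
    ∫ x, prodFun (Function.update (fun _ => p) k r) x • f x =
      ∫ x in cube ι L, periodization r L (x k) • f x := by
  rw [integral_prodFun_smul hL ?_ ?_ hfc hf]
  · congr 1 with x
    rw [prodFun_one_update _ x k fun j hj => by rw [Function.update_of_ne hj, hp1],
      Function.update_self]
  · intro j
    rcases eq_or_ne j k with rfl | h
    · rwa [Function.update_self]
    · rwa [Function.update_of_ne h]
  · intro j
    rcases eq_or_ne j k with rfl | h
    · rwa [Function.update_self]
    · rwa [Function.update_of_ne h]

theorem integral_prodFun_smul_of_partition {L : ℝ} (hL : 0 < L) {p : ℝ → ℝ}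
    (hp : Continuous p) (hps : HasCompactSupport p) (hp1 : ∀ t, periodization p L t = 1)
    {f : EuclideanSpace ℝ ι → F} (hfc : Continuous f) (hf : IsPeriodic L f) :
    ∫ x, prodFun (fun _ => p) x • f x = ∫ x in cube ι L, f x := by
  rw [integral_prodFun_smul hL (fun _ => hp) (fun _ => hps) hfc hf]
  congr 1 with x
  simp [prodFun, hp1]

theorem pd_pd_smul {c : EuclideanSpace ℝ ι → ℝ} {f : EuclideanSpace ℝ ι → F} (hc : ContDiff ℝ 2 c)
    (hf : ContDiff ℝ 2 f) (k : ι) (x : EuclideanSpace ℝ ι) :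
    pd k (pd k fun x => c x • f x) x =
      c x • pd k (pd k f) x + (2 : ℝ) • pd k c x • pd k f x + pd k (pd k c) x • f x := by
  have hc1 : Differentiable ℝ c := hc.differentiable (by simp)
  have hf1 : Differentiable ℝ f := hf.differentiable (by simp)
  have hc2 : Differentiable ℝ (pd k c) := (hc.pd (n := 1) k).differentiable (by simp)
  have hf2 : Differentiable ℝ (pd k f) := (hf.pd (n := 1) k).differentiable (by simp)
  rw [pd_smul hc1 hf1, pd_add (f := fun x => c x • pd k f x) (g := fun x => pd k c x • f x)
    (hc1.smul hf2) (hc2.smul hf1), pd_smul hc1 hf2, pd_smul hc2 hf1,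
    two_smul]
  simp only
  abel

theorem IsPeriodic.laplacian {L : ℝ} {f : EuclideanSpace ℝ ι → F} (hp : IsPeriodic L f)
    (hf : ContDiff ℝ 2 f) : IsPeriodic L (Δ f) := fun x k => by
  rw [laplacian_eq_sum_pd hf, laplacian_eq_sum_pd hf]
  exact Finset.sum_congr rfl fun j _ => (hp.pd j).pd j x k

theorem _root_.ContDiff.continuous_laplacian {f : EuclideanSpace ℝ ι → F} (hf : ContDiff ℝ 2 f) :
    Continuous (Δ f) := by
  rw [funext (laplacian_eq_sum_pd hf)]
  exact continuous_finsetSum _ fun k _ => ((hf.pd (n := 1) k).pd (n := 0) k).continuous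

/-- The kinetic energy of a localized periodic function: the localization error is given by the
periodization of `-q q''`. -/
theorem integral_kinetic_prodFun_smul {L : ℝ} (hL : 0 < L) {q : ℝ → ℝ} (hq : ContDiff ℝ 2 q)
    (hqs : HasCompactSupport q) (hq1 : ∀ t, periodization (fun t => q t * q t) L t = 1)
    {ψ : EuclideanSpace ℝ ι → ℂ} (hψ : ContDiff ℝ 2 ψ) (hp : IsPeriodic L ψ) :
    ∫ x, (starRingEnd ℂ (prodFun (fun _ => q) x • ψ x) *
        -(Δ fun x => prodFun (fun _ => q) x • ψ x) x).re =
      (∫ x in cube ι L, (starRingEnd ℂ (ψ x) * -(Δ ψ) x).re) +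
        ∑ k, ∫ x in cube ι L,
          periodization (fun t => -(q t * deriv (deriv q) t)) L (x k) * ‖ψ x‖ ^ 2 := by
  set Q : EuclideanSpace ℝ ι → ℝ := prodFun fun _ => q with hQ
  have hQ2 : ContDiff ℝ 2 Q := contDiff_prodFun fun _ => hq
  have hqd : Differentiable ℝ q := hq.differentiable (by simp)
  have hq' : ContDiff ℝ 1 (deriv q) := hq.iterate_deriv' 1 1
  have hq'd : Differentiable ℝ (deriv q) := hq'.differentiable (by simp)
  have hq'' : Continuous (deriv (deriv q)) := (hq.iterate_deriv' 0 2).continuous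
  set p : ℝ → ℝ := fun t => q t * q t
  have hpc : Continuous p := hq.continuous.mul hq.continuous
  have hps : HasCompactSupport p := hqs.mul_right
  set r₁ : ℝ → ℝ := fun t => q t * deriv q t
  set r₂ : ℝ → ℝ := fun t => -(q t * deriv (deriv q) t)
  have hr₁ : Continuous r₁ := hq.continuous.mul hq'.continuous
  have hr₂ : Continuous r₂ := (hq.continuous.mul hq'').neg
  have hr₁s : HasCompactSupport r₁ := hqs.mul_right
  have hr₂s : HasCompactSupport r₂ :=
    (hqs.mul_right : HasCompactSupport fun t => q t * deriv (deriv q) t).neg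
  -- The function 2qq' is the derivative of q², whose periodization is constant; this removes the
  -- cross term 2∇Q·∇ψ.
  have hr₁p : ∀ t, periodization r₁ L t = 0 := by
    have h : deriv p = fun t => 2 * r₁ t := funext fun t => by
      refine (HasDerivAt.congr_deriv ((hqd t).hasDerivAt.mul (hqd t).hasDerivAt) ?_).deriv
      simp only [r₁]; ring
    intro t
    have h1 := periodization_deriv_eq_zero (χ := p) (hqd.mul hqd) hps hL hq1 t
    rw [h, periodization, tsum_mul_left] at h1
    exact (mul_eq_zero.mp h1).resolve_left two_ne_zero
  have hpd : ∀ k, pd k Q = prodFun (Function.update (fun _ => q) k (deriv q)) :=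
    fun k => pd_prodFun (fun _ => hqd) k
  have hpdpd : ∀ k, pd k (pd k Q) = prodFun (Function.update (fun _ => q) k (deriv (deriv q))) :=
    fun k => by
      rw [hpd, pd_prodFun]
      · simp
      · intro j
        rcases eq_or_ne j k with rfl | h
        · rwa [Function.update_self]
        · rwa [Function.update_of_ne h]
  have hneg : ∀ (k : ι) x, -(Q x * pd k (pd k Q) x) = prodFun (Function.update (fun _ => p) k r₂) x :=
    fun k x => by
      rw [hpdpd, hQ, prodFun_mul_update, prodFun, prodFun, ← Finset.mul_prod_erase _ _
        (Finset.mem_univ k), ← Finset.mul_prod_erase _ _ (Finset.mem_univ k), ← neg_mul]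
      congr 1
      · simp [r₂]
      · exact Finset.prod_congr rfl fun j hj => by
          rw [Function.update_of_ne (Finset.ne_of_mem_erase hj),
            Function.update_of_ne (Finset.ne_of_mem_erase hj)]
  set A : EuclideanSpace ℝ ι → ℝ := fun x => (starRingEnd ℂ (ψ x) * -(Δ ψ) x).re
  set B : ι → EuclideanSpace ℝ ι → ℝ := fun k x => (starRingEnd ℂ (ψ x) * pd k ψ x).re
  have hA : Continuous A := Complex.continuous_re.comp
    ((Complex.continuous_conj.comp hψ.continuous).mul hψ.continuous_laplacian.neg)
  have hAp : IsPeriodic L A := fun x k => by simp only [A, hp x k, hp.laplacian hψ x k]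
  have hB : ∀ k, Continuous (B k) := fun k => Complex.continuous_re.comp
    ((Complex.continuous_conj.comp hψ.continuous).mul (hψ.pd (n := 1) k).continuous)
  have hBp : ∀ k, IsPeriodic L (B k) := fun k x j => by simp only [B, hp x j, hp.pd k x j]
  have hN : Continuous fun x => ‖ψ x‖ ^ 2 := hψ.continuous.norm.pow 2
  have hNp : IsPeriodic L fun x => ‖ψ x‖ ^ 2 := fun x k => by simp only [hp x k]
  -- Leibniz expansion of -Δ(Qψ) multiplied by Q·conj ψ. The weights Q², Q∂ₖQ and -Q∂ₖ²Q are
  -- products of q² over the coordinates, with the factor k replaced by qq' or -qq'' in the last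
  -- two.
  have hpoint : ∀ x, (starRingEnd ℂ (Q x • ψ x) * -(Δ fun x => Q x • ψ x) x).re =
      prodFun (fun _ => p) x • A x +
        ∑ k, (-2 * prodFun (Function.update (fun _ => p) k r₁) x • B k x +
          prodFun (Function.update (fun _ => p) k r₂) x • ‖ψ x‖ ^ 2) := by
    intro x
    have e1 : ∀ k, Q x * pd k Q x = prodFun (Function.update (fun _ => p) k r₁) x := fun k => by
      rw [hpd, hQ, prodFun_mul_update]
    have e2 : Q x * Q x = prodFun (fun _ => p) x := by rw [hQ, prodFun_mul]
    simp_rw [← hneg, ← e1, ← e2]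
    rw [laplacian_eq_sum_pd (f := fun x => Q x • ψ x) (hQ2.smul hψ)]
    simp only [pd_pd_smul hQ2 hψ, A, B]
    rw [laplacian_eq_sum_pd hψ, ← Finset.sum_neg_distrib, ← Finset.sum_neg_distrib,
      Finset.mul_sum, Finset.mul_sum, Complex.re_sum, Complex.re_sum, Finset.smul_sum,
      ← Finset.sum_add_distrib]
    refine Finset.sum_congr rfl fun k _ => ?_
    have hn : ‖ψ x‖ ^ 2 = (ψ x).re * (ψ x).re + (ψ x).im * (ψ x).im := by
      rw [← Complex.normSq_eq_norm_sq, Complex.normSq_apply]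
    rw [hn]
    simp only [Complex.real_smul, map_mul, Complex.conj_ofReal, smul_eq_mul, Complex.mul_re,
      Complex.neg_re, Complex.add_re, Complex.neg_im, Complex.add_im, Complex.ofReal_re,
      Complex.ofReal_im, Complex.conj_re, Complex.conj_im, Complex.mul_im]
    ring
  simp_rw [hpoint]
  have hcs : ∀ (k : ι) (r : ℝ → ℝ), HasCompactSupport r → HasCompactSupport
      (prodFun (Function.update (fun _ : ι => p) k r)) := fun k r hr =>
    hasCompactSupport_prodFun fun j => by
      rcases eq_or_ne j k with rfl | h
      · rwa [Function.update_self]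
      · rwa [Function.update_of_ne h]
  have hcc : ∀ (k : ι) (r : ℝ → ℝ), Continuous r → Continuous
      (prodFun (Function.update (fun _ : ι => p) k r)) := fun k r hr =>
    continuous_prodFun fun j => by
      rcases eq_or_ne j k with rfl | h
      · rwa [Function.update_self]
      · rwa [Function.update_of_ne h]
  have i0 : Integrable fun x => prodFun (fun _ => p) x • A x :=
    ((continuous_prodFun fun _ => hpc).smul hA).integrable_of_hasCompactSupport
      (hasCompactSupport_prodFun fun _ => hps).smul_right
  have i1 : ∀ k, Integrable fun x =>
      -2 * prodFun (Function.update (fun _ => p) k r₁) x • B k x := fun k =>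
    (((hcc k r₁ hr₁).smul (hB k)).integrable_of_hasCompactSupport
      (hcs k r₁ hr₁s).smul_right).const_mul _
  have i2 : ∀ k, Integrable fun x =>
      prodFun (Function.update (fun _ => p) k r₂) x • ‖ψ x‖ ^ 2 := fun k =>
    ((hcc k r₂ hr₂).smul hN).integrable_of_hasCompactSupport (hcs k r₂ hr₂s).smul_right
  have i12 : ∀ k, Integrable fun x => -2 * prodFun (Function.update (fun _ => p) k r₁) x • B k x +
      prodFun (Function.update (fun _ => p) k r₂) x • ‖ψ x‖ ^ 2 := fun k => (i1 k).add (i2 k)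
  rw [integral_add i0 (integrable_finsetSum _ fun k _ => i12 k), integral_finsetSum _ fun k _ => i12 k,
    integral_prodFun_smul_of_partition hL hpc hps hq1 hA hAp]
  congr 1
  refine Finset.sum_congr rfl fun k _ => ?_
  rw [integral_add (i1 k) (i2 k), integral_const_mul,
    integral_prodFun_update_smul hL hpc hps hr₁ hr₁s hq1 k (hB k) (hBp k),
    integral_prodFun_update_smul hL hpc hps hr₂ hr₂s hq1 k hN hNp]
  simp only [hr₁p, zero_mul, integral_zero, mul_zero, zero_add, smul_eq_mul]

end Localization
-- The Hamiltonian on a core as a nonnegative symmetric relation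
section Hamiltonian

variable {N : ℕ} {L : ℝ}

/-- An intersection of fixed-point sets of isometries. It provides the completeness that the
variational principle needs. -/
theorem isClosed_bosonSpace : IsClosed (bosonSpace N L : Set (Lp ℂ 2 (boxMeasure N L))) := by
  have h : (bosonSpace N L : Set (Lp ℂ 2 (boxMeasure N L))) = ⋂ σ : Equiv.Perm (Fin N),
      {Ψ | Lp.compMeasurePreserving (permute σ) (measurePreserving_permute L σ) Ψ = Ψ} := by
    ext Ψ
    rw [Set.mem_iInter]
    refine forall_congr' fun σ => ?_
    rw [Set.mem_ofPred_eq, Lp.ext_iff]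
    have h := Lp.coeFn_compMeasurePreserving Ψ (measurePreserving_permute L σ)
    exact ⟨fun h' => h.trans h', fun h' => h.symm.trans h'⟩
  rw [h]
  exact isClosed_iInter fun σ => isClosed_eq
    (Lp.isometry_compMeasurePreserving (measurePreserving_permute L σ)).continuous continuous_id

instance : CompleteSpace (bosonSpace N L) := isClosed_bosonSpace.completeSpace_coe

/-- The potential energy `∑_{i ≠ j} W(xᵢ - xⱼ)`. -/
noncomputable def pairPotential (W : Space → ℝ) (x : Config N) : ℝ :=
  ∑ i, ∑ j ∈ Finset.univ.erase i, W (particle x i - particle x j)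

theorem hamiltonianExpr_eq (W : Space → ℝ) (ψ : Config N → ℂ) (x : Config N) :
    hamiltonianExpr W ψ x = -(Δ ψ) x + (pairPotential W x : ℂ) * ψ x := rfl

theorem continuous_particle (i : Fin N) : Continuous fun x : Config N => particle x i :=
  (PiLp.continuous_toLp 2 _).comp (by fun_prop)

theorem continuous_pairPotential {W : Space → ℝ} (hW : Continuous W) :
    Continuous (pairPotential W : Config N → ℝ) :=
  continuous_finsetSum _ fun i _ => continuous_finsetSum _ fun j _ =>
    hW.comp ((continuous_particle i).sub (continuous_particle j))

theorem pairPotential_nonneg {W : Space → ℝ} (hW : ∀ x, 0 ≤ W x) (x : Config N) :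
    0 ≤ pairPotential W x :=
  Finset.sum_nonneg fun _ _ => Finset.sum_nonneg fun _ _ => hW _

theorem pairPotential_mono {V W : Space → ℝ} (h : ∀ x, V x ≤ W x) (x : Config N) :
    pairPotential V x ≤ pairPotential W x :=
  Finset.sum_le_sum fun _ _ => Finset.sum_le_sum fun _ _ => h _

theorem pairPotential_permute (W : Space → ℝ) (σ : Equiv.Perm (Fin N)) (x : Config N) :
    pairPotential W (permute σ x) = pairPotential W x := by
  have h : ∀ i, particle (permute σ x) i = particle x (σ i) := fun i => rfl
  simp only [pairPotential, h]
  refine Fintype.sum_equiv σ _ _ fun i => ?_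
  refine Finset.sum_equiv σ (fun j => ?_) fun j _ => rfl
  simp

/-- Cores of smooth functions on which partial integration over the box produces no boundary
terms. -/
structure IsCore (N : ℕ) (L : ℝ) (D : Set (Config N → ℂ)) : Prop where
  contDiff : ∀ ψ ∈ D, ContDiff ℝ ∞ ψ
  zero_mem : (0 : Config N → ℂ) ∈ D
  add_mem : ∀ φ ∈ D, ∀ ψ ∈ D, φ + ψ ∈ D
  smul_mem : ∀ c : ℂ, ∀ ψ ∈ D, c • ψ ∈ D
  integral_pd : ∀ φ ∈ D, ∀ ψ ∈ D, ∀ k,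
    ∫ x in cube (Fin N × Fin 3) L, pd k (fun x => starRingEnd ℂ (φ x) * pd k ψ x) x = 0

theorem isCore_periodicCore (hL : 0 < L) : IsCore N L (periodicCore N L) where
  contDiff ψ hψ := hψ.1
  zero_mem := ⟨contDiff_const, fun _ _ => rfl⟩
  add_mem φ hφ ψ hψ := ⟨hφ.1.add hψ.1, fun x k => by
    rw [Pi.add_apply, Pi.add_apply, hφ.2, hψ.2]⟩
  smul_mem c ψ hψ := ⟨contDiff_const.smul hψ.1, fun x k => by
    rw [Pi.smul_apply, Pi.smul_apply, hψ.2]⟩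
  integral_pd φ hφ ψ hψ k := by
    have hp : IsPeriodic L ψ := hψ.2
    refine integral_cube_pd_of_periodic hL ?_ (fun x j => ?_) k
    · exact (Complex.conjCLE.contDiff.comp (hφ.1.of_le (by simp))).mul
        ((hψ.1.of_le (n := ∞) (m := 1 + 1) (by norm_cast)).pd k)
    · simp only [hφ.2 x j, hp.pd k x j]

theorem isCore_dirichletCore : IsCore N L (dirichletCore N L) where
  contDiff ψ hψ := hψ.1
  zero_mem := ⟨contDiff_const, HasCompactSupport.zero, by simp [tsupport]⟩
  add_mem φ hφ ψ hψ := ⟨hφ.1.add hψ.1, hφ.2.1.add hψ.2.1,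
    (tsupport_add φ ψ).trans (Set.union_subset hφ.2.2 hψ.2.2)⟩
  smul_mem c ψ hψ := ⟨contDiff_const.smul hψ.1, hψ.2.1.smul_left (f := fun _ => c),
    (closure_mono (Function.support_const_smul_subset c ψ)).trans hψ.2.2⟩
  integral_pd φ hφ ψ hψ k := by
    refine integral_cube_pd_of_tsupport ?_ ?_ k
    · exact (Complex.conjCLE.contDiff.comp (hφ.1.of_le (by simp))).mul
        ((hψ.1.of_le (n := ∞) (m := 1 + 1) (by norm_cast)).pd k)
    · refine (tsupport_mul_subset_right).trans ((tsupport_pd_subset k ψ).trans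
        (hψ.2.2.trans fun x hx j => Set.Ioo_subset_Icc_self (hx j)))

theorem hamiltonianExpr_add (W : Space → ℝ) {φ ψ : Config N → ℂ} (hφ : ContDiff ℝ 2 φ)
    (hψ : ContDiff ℝ 2 ψ) :
    hamiltonianExpr W (φ + ψ) = hamiltonianExpr W φ + hamiltonianExpr W ψ := funext fun x => by
  rw [Pi.add_apply, hamiltonianExpr_eq, hamiltonianExpr_eq, hamiltonianExpr_eq,
    hφ.contDiffAt.laplacian_add hψ.contDiffAt, Pi.add_apply]
  ring

theorem hamiltonianExpr_smul (W : Space → ℝ) (c : ℂ) {ψ : Config N → ℂ} (hψ : ContDiff ℝ 2 ψ) :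
    hamiltonianExpr W (c • ψ) = c • hamiltonianExpr W ψ := funext fun x => by
  rw [Pi.smul_apply, hamiltonianExpr_eq, hamiltonianExpr_eq,
    InnerProductSpace.laplacian_smul c hψ.contDiffAt, Pi.smul_apply]
  simp only [smul_eq_mul]
  ring

theorem _root_.ContDiff.two_of_infty {ψ : Config N → ℂ} (hψ : ContDiff ℝ ∞ ψ) : ContDiff ℝ 2 ψ :=
  hψ.of_le (by norm_cast)

variable {D : Set (Config N → ℂ)}

/-- The Hamiltonian on a core, as a linear relation. -/
def hamiltonianSubmodule (hD : IsCore N L D) (W : Space → ℝ) :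
    Submodule ℂ (bosonSpace N L × bosonSpace N L) where
  carrier := hamiltonianOn N L W D
  zero_mem' := by
    refine ⟨0, hD.zero_mem, fun _ _ => rfl, Lp.coeFn_zero _ _ _, ?_⟩
    have h : hamiltonianExpr W (0 : Config N → ℂ) = 0 := funext fun x => by
      have h1 := congrFun (hamiltonianExpr_smul W 0 (ψ := (0 : Config N → ℂ)) contDiff_const) x
      simpa using h1
    rw [h]
    exact Lp.coeFn_zero _ _ _
  add_mem' := by
    rintro p p' ⟨φ, hφD, hφσ, h1, h2⟩ ⟨ψ, hψD, hψσ, h1', h2'⟩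
    refine ⟨φ + ψ, hD.add_mem φ hφD ψ hψD, fun σ x => ?_, ?_, ?_⟩
    · rw [Pi.add_apply, hφσ, hψσ, Pi.add_apply]
    · exact (Lp.coeFn_add _ _).trans (h1.add h1')
    · rw [hamiltonianExpr_add W (hD.contDiff φ hφD).two_of_infty
        (hD.contDiff ψ hψD).two_of_infty]
      exact (Lp.coeFn_add _ _).trans (h2.add h2')
  smul_mem' := by
    rintro c p ⟨ψ, hψD, hψσ, h1, h2⟩
    refine ⟨c • ψ, hD.smul_mem c ψ hψD, fun σ x => ?_, ?_, ?_⟩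
    · rw [Pi.smul_apply, hψσ, Pi.smul_apply]
    · exact (Lp.coeFn_smul _ _).trans (h1.const_smul c)
    · rw [hamiltonianExpr_smul W c (hD.contDiff ψ hψD).two_of_infty]
      exact (Lp.coeFn_smul _ _).trans (h2.const_smul c)

theorem inner_bosonSpace {Φ Ψ : bosonSpace N L} {φ ψ : Config N → ℂ}
    (hφ : (Φ : Lp ℂ 2 (boxMeasure N L)) =ᵐ[boxMeasure N L] φ)
    (hψ : (Ψ : Lp ℂ 2 (boxMeasure N L)) =ᵐ[boxMeasure N L] ψ) :
    inner ℂ Φ Ψ = ∫ x in cube (Fin N × Fin 3) L, starRingEnd ℂ (φ x) * ψ x := by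
  change @inner ℂ (bosonSpace N L) InnerProductSpace.toInner Φ Ψ = _
  rw [Submodule.coe_inner, L2.inner_def]
  refine integral_congr_ae ?_
  filter_upwards [hφ, hψ] with x h1 h2
  rw [h1, h2, RCLike.inner_apply, mul_comm]

theorem norm_sq_bosonSpace {Ψ : bosonSpace N L} {ψ : Config N → ℂ}
    (hψ : (Ψ : Lp ℂ 2 (boxMeasure N L)) =ᵐ[boxMeasure N L] ψ) :
    ‖Ψ‖ ^ 2 = ∫ x in cube (Fin N × Fin 3) L, ‖ψ x‖ ^ 2 := by
  have h := inner_bosonSpace hψ hψ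
  simp_rw [Complex.conj_mul'] at h
  have h0 : inner ℂ Ψ Ψ = ((‖Ψ‖ ^ 2 : ℝ) : ℂ) := by
    push_cast
    exact inner_self_eq_norm_sq_to_K Ψ
  have h2 : ∫ x in cube (Fin N × Fin 3) L, ((‖ψ x‖ : ℂ)) ^ 2 =
      ((∫ x in cube (Fin N × Fin 3) L, ‖ψ x‖ ^ 2 : ℝ) : ℂ) := by
    rw [← integral_complex_ofReal]
    simp
  rw [h2, h0] at h
  exact Complex.ofReal_injective h

/-- The Hamiltonian in form language. -/
theorem IsCore.integral_conj_mul_hamiltonianExpr (hD : IsCore N L D) {W : Space → ℝ}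
    (hW : Continuous W) {φ ψ : Config N → ℂ} (hφ : φ ∈ D) (hψ : ψ ∈ D) :
    ∫ x in cube (Fin N × Fin 3) L, starRingEnd ℂ (φ x) * hamiltonianExpr W ψ x =
      (∑ k, ∫ x in cube (Fin N × Fin 3) L, starRingEnd ℂ (pd k φ x) * pd k ψ x) +
        ∫ x in cube (Fin N × Fin 3) L,
          (pairPotential W x : ℂ) * (starRingEnd ℂ (φ x) * ψ x) := by
  have hφ2 := (hD.contDiff φ hφ).two_of_infty
  have hψ2 := (hD.contDiff ψ hψ).two_of_infty
  have hφd : Differentiable ℝ φ := hφ2.differentiable (by simp)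
  have hcφ : Continuous fun x => starRingEnd ℂ (φ x) :=
    Complex.continuous_conj.comp hφ2.continuous
  have hφc : Differentiable ℝ fun x => starRingEnd ℂ (φ x) :=
    Complex.conjCLE.differentiable.comp hφd
  have hpdφ : ∀ k, Continuous (pd k φ) := fun k => (hφ2.pd (n := 1) k).continuous
  have hpdψ : ∀ k, Continuous (pd k ψ) := fun k => (hψ2.pd (n := 1) k).continuous
  have hpdpdψ : ∀ k, Continuous (pd k (pd k ψ)) := fun k =>
    ((hψ2.pd (n := 1) k).pd (n := 0) k).continuous
  have hk : ∀ k, -∫ x in cube (Fin N × Fin 3) L, starRingEnd ℂ (φ x) * pd k (pd k ψ) x =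
      ∫ x in cube (Fin N × Fin 3) L, starRingEnd ℂ (pd k φ x) * pd k ψ x := fun k => by
    have h := hD.integral_pd φ hφ ψ hψ k
    rw [pd_mul hφc ((hψ2.pd (n := 1) k).differentiable (by simp)), pd_conj hφd,
      integral_add (f := fun x => starRingEnd ℂ (φ x) * pd k (pd k ψ) x)
      (g := fun x => starRingEnd ℂ (pd k φ x) * pd k ψ x) (hcφ.mul (hpdpdψ k)).integrableOn_cube
      ((Complex.continuous_conj.comp (hpdφ k)).mul (hpdψ k)).integrableOn_cube] at h
    exact neg_eq_of_add_eq_zero_right h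
  have e : ∀ x, starRingEnd ℂ (φ x) * hamiltonianExpr W ψ x =
      (∑ k, -(starRingEnd ℂ (φ x) * pd k (pd k ψ) x)) +
        (pairPotential W x : ℂ) * (starRingEnd ℂ (φ x) * ψ x) := fun x => by
    rw [hamiltonianExpr_eq, laplacian_eq_sum_pd hψ2, Finset.sum_neg_distrib, ← Finset.mul_sum]
    ring
  simp_rw [e]
  have i1 : ∀ k, IntegrableOn (fun x => -(starRingEnd ℂ (φ x) * pd k (pd k ψ) x))
      (cube (Fin N × Fin 3) L) := fun k => (hcφ.mul (hpdpdψ k)).neg.integrableOn_cube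
  have i2 : IntegrableOn (fun x => (pairPotential W x : ℂ) * (starRingEnd ℂ (φ x) * ψ x))
      (cube (Fin N × Fin 3) L) := ((Complex.continuous_ofReal.comp
        (continuous_pairPotential hW)).mul (hcφ.mul hψ2.continuous)).integrableOn_cube
  rw [integral_add (integrable_finsetSum _ fun k _ => i1 k) i2,
    integral_finsetSum _ fun k _ => i1 k]
  congr 1
  exact Finset.sum_congr rfl fun k _ => by rw [integral_neg, hk]

/-- After partial integration the form is ∑ₖ⟨∂ₖφ, ∂ₖψ⟩ + ⟨φ, Uψ⟩ with U ≥ 0, visibly Hermitian and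
nonnegative. -/
theorem IsCore.isNonnegSymmetric (hD : IsCore N L D) {W : Space → ℝ} (hW : Continuous W)
    (hW0 : ∀ x, 0 ≤ W x) : IsNonnegSymmetric (hamiltonianSubmodule hD W) where
  symm := by
    rintro p ⟨φ, hφ, -, hp1, hp2⟩ q ⟨ψ, hψ, -, hq1, hq2⟩
    have e : starRingEnd ℂ (inner ℂ q.1 p.2) = inner ℂ p.2 q.1 :=
      inner_conj_symm (𝕜 := ℂ) p.2 q.1
    rw [← e, inner_bosonSpace hq1 hp2, inner_bosonSpace hp1 hq2,
      hD.integral_conj_mul_hamiltonianExpr hW hψ hφ, hD.integral_conj_mul_hamiltonianExpr hW hφ hψ,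
      map_add, map_sum]
    simp_rw [← integral_conj, map_mul, Complex.conj_conj, Complex.conj_ofReal, mul_comm]
  nonneg := by
    rintro p ⟨ψ, hψ, -, hp1, hp2⟩
    rw [inner_bosonSpace hp1 hp2, hD.integral_conj_mul_hamiltonianExpr hW hψ hψ]
    have h1 : ∀ k, ∫ x in cube (Fin N × Fin 3) L, starRingEnd ℂ (pd k ψ x) * pd k ψ x =
        ((∫ x in cube (Fin N × Fin 3) L, ‖pd k ψ x‖ ^ 2 : ℝ) : ℂ) := fun k => by
      rw [← integral_complex_ofReal]
      simp_rw [Complex.conj_mul', Complex.ofReal_pow]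
    have h2 : ∫ x in cube (Fin N × Fin 3) L,
        (pairPotential W x : ℂ) * (starRingEnd ℂ (ψ x) * ψ x) =
        ((∫ x in cube (Fin N × Fin 3) L, pairPotential W x * ‖ψ x‖ ^ 2 : ℝ) : ℂ) := by
      rw [← integral_complex_ofReal]
      simp_rw [Complex.conj_mul', Complex.ofReal_mul, Complex.ofReal_pow]
    simp_rw [h1, h2, ← Complex.ofReal_sum, ← Complex.ofReal_add, Complex.ofReal_re]
    refine add_nonneg (Finset.sum_nonneg fun k _ => integral_nonneg fun x => by positivity)
      (integral_nonneg fun x => mul_nonneg (pairPotential_nonneg hW0 x) (by positivity))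

end Hamiltonian
-- Permutation invariance, and elements of the relation built from functions
section Symmetrization

variable {N : ℕ} {L : ℝ}

/-- Relabelling of the particles as a linear isometry. -/
noncomputable def permuteEquiv (σ : Equiv.Perm (Fin N)) : Config N ≃L[ℝ] Config N :=
  (LinearIsometryEquiv.piLpCongrLeft 2 ℝ ℝ
    ((Equiv.prodCongr σ (Equiv.refl (Fin 3))).symm)).toContinuousLinearEquiv

theorem coe_permuteEquiv (σ : Equiv.Perm (Fin N)) : ⇑(permuteEquiv σ) = permute σ := by
  ext x k
  rfl

theorem permute_single (σ : Equiv.Perm (Fin N)) (k : Fin N × Fin 3) :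
    permute σ (EuclideanSpace.single k 1) = EuclideanSpace.single (σ.symm k.1, k.2) 1 := by
  ext j
  have h : (σ j.1, j.2) = k ↔ j = (σ.symm k.1, k.2) := by
    rw [Prod.ext_iff, Prod.ext_iff, Equiv.eq_symm_apply]
  simp only [permute, PiLp.single_apply, h]

theorem pd_comp_permute (σ : Equiv.Perm (Fin N)) (f : Config N → ℂ) (k : Fin N × Fin 3) :
    pd k (f ∘ permute σ) = pd (σ.symm k.1, k.2) f ∘ permute σ := funext fun x => by
  rw [Function.comp_apply, pd, pd, ← coe_permuteEquiv, ContinuousLinearEquiv.comp_right_fderiv,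
    ContinuousLinearMap.comp_apply, ContinuousLinearEquiv.coe_coe, coe_permuteEquiv, permute_single]

theorem laplacian_permute {ψ : Config N → ℂ} (hψ : ContDiff ℝ 2 ψ)
    (hσ : ∀ (σ : Equiv.Perm (Fin N)) x, ψ (permute σ x) = ψ x) (σ : Equiv.Perm (Fin N))
    (x : Config N) : (Δ ψ) (permute σ x) = (Δ ψ) x := by
  have h : ψ ∘ permute σ = ψ := funext (hσ σ)
  rw [laplacian_eq_sum_pd hψ, laplacian_eq_sum_pd hψ]
  symm
  refine Fintype.sum_equiv (Equiv.prodCongr σ.symm (Equiv.refl (Fin 3))) _ _ fun k => ?_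
  conv_lhs => rw [← h, pd_comp_permute, pd_comp_permute]
  rfl

/-- Ensures that the image of a symmetric core function is again a bosonic state, so that the
function really gives a point of the graph. -/
theorem hamiltonianExpr_permute (W : Space → ℝ) {ψ : Config N → ℂ} (hψ : ContDiff ℝ 2 ψ)
    (hσ : ∀ (σ : Equiv.Perm (Fin N)) x, ψ (permute σ x) = ψ x) (σ : Equiv.Perm (Fin N))
    (x : Config N) : hamiltonianExpr W ψ (permute σ x) = hamiltonianExpr W ψ x := by
  rw [hamiltonianExpr_eq, hamiltonianExpr_eq, laplacian_permute hψ hσ, hσ, pairPotential_permute]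

theorem continuous_hamiltonianExpr {W : Space → ℝ} (hW : Continuous W) {ψ : Config N → ℂ}
    (hψ : ContDiff ℝ 2 ψ) : Continuous (hamiltonianExpr W ψ) :=
  hψ.continuous_laplacian.neg.add
    ((Complex.continuous_ofReal.comp (continuous_pairPotential hW)).mul hψ.continuous)

theorem exists_bosonSpace_ae_eq {g : Config N → ℂ} (hg : Continuous g)
    (hσ : ∀ (σ : Equiv.Perm (Fin N)) x, g (permute σ x) = g x) :
    ∃ Ψ : bosonSpace N L, (Ψ : Lp ℂ 2 (boxMeasure N L)) =ᵐ[boxMeasure N L] g := by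
  have hfin : IsFiniteMeasure (boxMeasure N L) :=
    ⟨by rw [boxMeasure, Measure.restrict_apply_univ]; exact (isCompact_cube L).measure_lt_top⟩
  obtain ⟨C, hC⟩ := (isCompact_cube (ι := Fin N × Fin 3) L).exists_bound_of_continuousOn
    hg.continuousOn
  have hmem : MemLp g 2 (boxMeasure N L) := by
    refine MemLp.of_bound hg.aestronglyMeasurable C ?_
    exact (ae_restrict_iff' (measurableSet_cube L)).mpr (ae_of_all _ hC)
  refine ⟨⟨hmem.toLp g, fun σ => ?_⟩, hmem.coeFn_toLp⟩
  have h0 := hmem.coeFn_toLp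
  have h1 := (measurePreserving_permute L σ).quasiMeasurePreserving.ae h0
  filter_upwards [h0, h1] with x hx hx'
  rw [hx, hx', hσ]

theorem exists_mem_hamiltonianSubmodule {D : Set (Config N → ℂ)} (hD : IsCore N L D)
    {W : Space → ℝ} (hW : Continuous W) {ψ : Config N → ℂ} (hψ : ψ ∈ D)
    (hσ : ∀ (σ : Equiv.Perm (Fin N)) x, ψ (permute σ x) = ψ x) :
    ∃ p ∈ hamiltonianSubmodule hD W,
      (p.1 : Lp ℂ 2 (boxMeasure N L)) =ᵐ[boxMeasure N L] ψ ∧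
      (p.2 : Lp ℂ 2 (boxMeasure N L)) =ᵐ[boxMeasure N L] hamiltonianExpr W ψ := by
  have hψ2 := (hD.contDiff ψ hψ).two_of_infty
  obtain ⟨Ψ, hΨ⟩ := exists_bosonSpace_ae_eq (L := L) hψ2.continuous hσ
  obtain ⟨Φ, hΦ⟩ := exists_bosonSpace_ae_eq (L := L) (continuous_hamiltonianExpr hW hψ2)
    (hamiltonianExpr_permute W hψ2 hσ)
  exact ⟨(Ψ, Φ), ⟨ψ, hψ, hσ, hΨ, hΦ⟩, hΨ, hΦ⟩

end Symmetrization

/-! ### Convergence, continuity and monotonicity of the periodized potential -/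

section PeriodicPotential

variable {V : Space → ℝ} {L : ℝ}

/-- The exponent 4 exceeds the rank 3 of the lattice. The term n = 0 has the default value 0. -/
theorem summable_latticeVec_norm_pow : Summable fun n : Fin 3 → ℤ => (‖latticeVec 1 n‖ ^ 4)⁻¹ := by
  set b := (EuclideanSpace.basisFun (Fin 3) ℝ).toBasis
  have hmem : ∀ n : Fin 3 → ℤ, latticeVec 1 n ∈ Submodule.span ℤ (Set.range b) := fun n => by
    rw [latticeVec_eq_sum]
    refine Submodule.sum_mem _ fun k _ => Submodule.smul_mem _ _ (Submodule.subset_span ⟨k, ?_⟩)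
    simp [b]
  have hrank : Module.finrank ℤ (Submodule.span ℤ (Set.range b)) < 4 := by
    rw [ZLattice.rank ℝ]
    simp
  have h := ZLattice.summable_norm_pow_inv (Submodule.span ℤ (Set.range b)) 4 hrank
  have hinj : Function.Injective fun n : Fin 3 → ℤ =>
      (⟨latticeVec 1 n, hmem n⟩ : Submodule.span ℤ (Set.range b)) := fun n m hnm => by
    have h1 := congrArg Subtype.val hnm
    funext k
    have h2 := congrFun (congrArg WithLp.ofLp h1) k
    simpa [latticeVec] using h2
  exact (h.comp_injective hinj).congr fun n => inv_pow _ _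

/-- A bound that is summable over the lattice and locally uniform in x, as the Weierstrass test
requires. The decay of V at x + v is converted into decay in v by Peetre's inequality 1 + |v| ≤ (1 +
|x|)(1 + |x + v|). -/
theorem IsInteractionPotential.exists_bound (hV : IsInteractionPotential V) (hL : 0 < L) :
    ∃ u : (Fin 3 → ℤ) → ℝ, Summable u ∧
      ∀ n x, ‖V (x + latticeVec L n)‖ ≤ (1 + ‖x‖) ^ 4 * u n := by
  obtain ⟨C₀, hC₀⟩ := hV.decay 0
  obtain ⟨C₄, hC₄⟩ := hV.decay 4
  have hC0 : 0 ≤ C₀ := le_trans (by simpa using hV.nonneg 0) (hC₀ 0)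
  have hC4 : 0 ≤ C₄ := le_trans (mul_nonneg (by positivity) (hV.nonneg 0)) (hC₄ 0)
  have hdec : ∀ y, (1 + ‖y‖) ^ 4 * V y ≤ 8 * (C₀ + C₄) := fun y => by
    have h0 := hC₀ y
    have h4 := hC₄ y
    have h : (1 + ‖y‖) ^ 4 ≤ 8 * (1 + ‖y‖ ^ 4) := by
      nlinarith [sq_nonneg (‖y‖ - 1), sq_nonneg (‖y‖ ^ 2 - 1), sq_nonneg (‖y‖ * (‖y‖ - 1)),
        norm_nonneg y]
    calc _ ≤ 8 * (1 + ‖y‖ ^ 4) * V y := mul_le_mul_of_nonneg_right h (hV.nonneg y)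
      _ = 8 * (‖y‖ ^ 0 * V y + ‖y‖ ^ 4 * V y) := by ring
      _ ≤ _ := by gcongr
  set C := 8 * (C₀ + C₄)
  -- The indicator covers n = 0, where the inverse power is the default 0.
  refine ⟨fun n => C * ((L ^ 4)⁻¹ * (‖latticeVec 1 n‖ ^ 4)⁻¹ + if n = 0 then 1 else 0),
    ((summable_latticeVec_norm_pow.mul_left _).add
      (summable_of_hasFiniteSupport ((Set.finite_singleton 0).subset fun n hn => ?_))).mul_left _,
    fun n x => ?_⟩
  · by_contra h
    exact hn (if_neg h)
  · rw [Real.norm_of_nonneg (hV.nonneg _)]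
    set v := latticeVec L n with hv
    have hpeetre : 1 + ‖v‖ ≤ (1 + ‖x‖) * (1 + ‖x + v‖) := by
      have : ‖v‖ ≤ ‖x + v‖ + ‖x‖ := by
        have := norm_sub_le (x + v) x
        rwa [add_sub_cancel_left] at this
      nlinarith [norm_nonneg x, norm_nonneg (x + v), mul_nonneg (norm_nonneg x) (norm_nonneg (x + v))]
    have h1 : (1 + ‖v‖) ^ 4 * V (x + v) ≤ (1 + ‖x‖) ^ 4 * C := by
      calc _ ≤ ((1 + ‖x‖) * (1 + ‖x + v‖)) ^ 4 * V (x + v) :=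
            mul_le_mul_of_nonneg_right (pow_le_pow_left₀ (by positivity) hpeetre 4) (hV.nonneg _)
        _ = (1 + ‖x‖) ^ 4 * ((1 + ‖x + v‖) ^ 4 * V (x + v)) := by ring
        _ ≤ _ := mul_le_mul_of_nonneg_left (hdec _) (by positivity)
    have h2 : ((1 + ‖v‖) ^ 4)⁻¹ ≤
        (L ^ 4)⁻¹ * (‖latticeVec 1 n‖ ^ 4)⁻¹ + if n = 0 then 1 else 0 := by
      by_cases hn : n = 0
      · rw [if_pos hn]
        have : ((1 + ‖v‖) ^ 4)⁻¹ ≤ 1 := inv_le_one_of_one_le₀ (one_le_pow₀ (by simp))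
        have : 0 ≤ (L ^ 4)⁻¹ * (‖latticeVec 1 n‖ ^ 4)⁻¹ := by positivity
        linarith
      · rw [if_neg hn, add_zero, ← mul_inv, ← mul_pow]
        have hv1 : v = L • latticeVec 1 n := by
          ext k; simp [hv, latticeVec, mul_comm]
        have hv2 : ‖v‖ = L * ‖latticeVec 1 n‖ := by
          rw [hv1, norm_smul, Real.norm_of_nonneg hL.le]
        have hne : latticeVec 1 n ≠ 0 := fun h => hn (funext fun k => by
          have h2 := congrFun (congrArg WithLp.ofLp h) k
          simpa [latticeVec] using h2)
        rw [← hv2]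
        have hvpos : 0 < ‖v‖ := by rw [hv2]; exact mul_pos hL (norm_pos_iff.mpr hne)
        exact inv_anti₀ (by positivity) (pow_le_pow_left₀ hvpos.le (by linarith) 4)
    calc V (x + v) = ((1 + ‖v‖) ^ 4)⁻¹ * ((1 + ‖v‖) ^ 4 * V (x + v)) := by field_simp
      _ ≤ ((1 + ‖v‖) ^ 4)⁻¹ * ((1 + ‖x‖) ^ 4 * C) := mul_le_mul_of_nonneg_left h1 (by positivity)
      _ ≤ _ * ((1 + ‖x‖) ^ 4 * C) := mul_le_mul_of_nonneg_right h2 (by positivity)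
      _ = _ := by ring

theorem IsInteractionPotential.continuous_periodize (hV : IsInteractionPotential V) (hL : 0 < L) :
    Continuous (periodize V L) := by
  obtain ⟨u, hu, hb⟩ := hV.exists_bound hL
  have hu0 : ∀ n, 0 ≤ u n := fun n => by
    have := (norm_nonneg _).trans (hb n 0)
    simpa using this
  rw [continuous_iff_continuousAt]
  intro x
  have h : ContinuousOn (periodize V L) (Metric.ball x 1) := by
    refine continuousOn_tsum (u := fun n => (1 + (‖x‖ + 1)) ^ 4 * u n) (fun n => ?_)
      (hu.mul_left _) fun n y hy => (hb n y).trans ?_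
    · exact (hV.smooth.continuous.comp (continuous_id.add continuous_const)).continuousOn
    · refine mul_le_mul_of_nonneg_right (pow_le_pow_left₀ (by positivity) ?_ 4) (hu0 n)
      have := norm_le_norm_add_norm_sub x y
      rw [Metric.mem_ball, dist_comm, dist_eq_norm] at hy
      linarith
  exact h.continuousAt (Metric.ball_mem_nhds x one_pos)

/-- V is the term n = 0 of a series of nonnegative terms; summability matters, since a divergent
`tsum` would be 0. -/
theorem IsInteractionPotential.le_periodize (hV : IsInteractionPotential V) (hL : 0 < L)
    (x : Space) : V x ≤ periodize V L x := by
  obtain ⟨u, hu, hb⟩ := hV.exists_bound hL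
  have hs : Summable fun n => V (x + latticeVec L n) :=
    .of_norm_bounded (hu.mul_left _) fun n => hb n x
  have h := hs.le_tsum 0 fun n _ => hV.nonneg _
  have h0 : x + latticeVec L 0 = x := by
    rw [add_eq_left]; ext k; simp [latticeVec]
  rwa [h0] at h

theorem periodize_add_latticeVec (V : Space → ℝ) (L : ℝ) (x : Space) (m : Fin 3 → ℤ) :
    periodize V L (x + latticeVec L m) = periodize V L x := by
  unfold periodize
  rw [← (Equiv.addLeft m).tsum_eq fun n : Fin 3 → ℤ => V (x + WithLp.toLp 2 fun a => (n a : ℝ) * L)]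
  refine tsum_congr fun n => congrArg V ?_
  ext a
  simp [latticeVec]
  ring

/-- Moving one coordinate of one particle by L changes all differences of positions by lattice
vectors. -/
theorem isPeriodic_pairPotential {N : ℕ} (V : Space → ℝ) (L : ℝ) :
    IsPeriodic L (pairPotential (periodize V L) : Config N → ℝ) := fun x k => by
  set m : Fin N → Fin 3 → ℤ := fun i a => if (i, a) = k then 1 else 0 with hm
  have h : ∀ i, particle (x + EuclideanSpace.single k L) i = particle x i + latticeVec L (m i) :=
    fun i => by
      ext a
      simp only [particle, latticeVec, hm, PiLp.add_apply, PiLp.single_apply]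
      split_ifs <;> simp
  have h2 : ∀ i j, latticeVec L (m i) - latticeVec L (m j) = latticeVec L (m i - m j) :=
    fun i j => by
      ext a
      simp [latticeVec]
      ring
  simp only [pairPotential, h, add_sub_add_comm, h2, periodize_add_latticeVec]

end PeriodicPotential
-- Diagonal translations and averaging over them
section Translation

variable {ι : Type*} [Fintype ι]

/-- The vector all of whose coordinates are `a`. -/
noncomputable def diagonal (ι : Type*) (a : ℝ) : EuclideanSpace ℝ ι := WithLp.toLp 2 fun _ => a

theorem IsPeriodic.comp_add {ι : Type*} [DecidableEq ι] {α : Type*} {L : ℝ} {f : EuclideanSpace ℝ ι → α}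
    (hf : IsPeriodic L f) (c : EuclideanSpace ℝ ι) : IsPeriodic L fun x => f (x + c) :=
  fun x k => by
    change f (x + EuclideanSpace.single k L + c) = f (x + c)
    rw [add_right_comm, hf]

theorem volume_cube_pos {L : ℝ} (hL : 0 < L) : 0 < volume.real (cube ι L) := by
  have h : volume (cube ι L) = ENNReal.ofReal L ^ Fintype.card ι := by
    rw [cube_eq_preimage, (PiLp.volume_preserving_ofLp ι).measure_preimage
      measurableSet_Icc.nullMeasurableSet, Real.volume_Icc_pi]
    simp
  rw [Measure.real, h, ENNReal.toReal_pow, ENNReal.toReal_ofReal hL.le]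
  positivity

/-- The integral of a periodic function over a period is translation invariant. -/
theorem integral_cube_comp_add [DecidableEq ι] {L : ℝ} (hL : 0 < L) {f : EuclideanSpace ℝ ι → ℝ}
    (hfc : Continuous f) (hf : IsPeriodic L f) (a : ℝ) :
    ∫ x in cube ι L, f (x + diagonal ι a) = ∫ x in cube ι L, f x := by
  set p : ℝ → ℝ := fun t => cutoff L L t ^ 2
  have hp : Continuous p := (contDiff_cutoff (n := 0)).continuous.pow 2
  have hps : HasCompactSupport p :=
    (hasCompactSupport_cutoff (L := L) hL).comp_left (g := fun y => y ^ 2) (by simp)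
  have hp1 : ∀ t, periodization p L t = 1 := periodization_cutoff_sq hL le_rfl
  -- A translated partition of unity is again one: both sides unfold to whole-space integrals, where
  -- translation invariance is available.
  have hps' : HasCompactSupport fun t => p (t - a) := hps.comp_homeomorph (Homeomorph.subRight a)
  have hp1' : ∀ t, periodization (fun t => p (t - a)) L t = 1 := fun t => by
    rw [periodization_comp_sub, hp1]
  have hfa : Continuous fun x => f (x + diagonal ι a) :=
    hfc.comp (continuous_id.add continuous_const)
  have hpa : Continuous fun t => p (t - a) := hp.comp (by fun_prop)
  rw [← integral_prodFun_smul_of_partition (f := fun x => f (x + diagonal ι a)) hL hp hps hp1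
    hfa (hf.comp_add _), ← integral_prodFun_smul_of_partition hL hpa hps' hp1' hfc hf,
    ← integral_add_right_eq_self (fun x => prodFun (fun _ t => p (t - a)) x • f x) (diagonal ι a)]
  congr 1 with x
  simp [prodFun, diagonal]

/-- Some shift does at least as well as the mean over a ∈ [0, L], and averaging replaces each e(x_k
- a) by the mean of e over a period. One real parameter suffices because the error is a sum of
functions of single coordinates; a shift common to all coordinates also preserves bosonic symmetry.
-/
theorem exists_average_le {L : ℝ} (hL : 0 < L) {e : ℝ → ℝ} (he : Continuous e)
    (hep : Function.Periodic e L) {ρ : EuclideanSpace ℝ ι → ℝ} (hρ : Continuous ρ) :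
    ∃ a : ℝ, ∫ x in cube ι L, (∑ k, e (x k - a)) * ρ x ≤
      Fintype.card ι * ((∫ t in (0)..L, e t) / L) * ∫ x in cube ι L, ρ x := by
  set G : ℝ → EuclideanSpace ℝ ι → ℝ := fun a x => (∑ k, e (x k - a)) * ρ x with hG
  have hGc : Continuous (Function.uncurry G) := by
    simp only [hG, Function.uncurry_def]
    exact (continuous_finsetSum _ fun k _ => he.comp (by fun_prop)).mul (hρ.comp continuous_snd)
  have hint : Integrable (Function.uncurry G)
      ((volume.restrict (Set.Icc 0 L)).prod (volume.restrict (cube ι L))) := by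
    rw [Measure.prod_restrict]
    exact hGc.continuousOn.integrableOn_compact (isCompact_Icc.prod (isCompact_cube L))
  have hvol : volume (Set.Icc 0 L) ≠ 0 := by simp [hL]
  obtain ⟨a, -, ha⟩ := exists_le_setAverage hvol (by simp) hint.integral_prod_left
  refine ⟨a, ha.trans (le_of_eq ?_)⟩
  have hinner : ∀ x : EuclideanSpace ℝ ι, ∫ a in Set.Icc 0 L, G a x =
      (Fintype.card ι * ∫ t in (0)..L, e t) * ρ x := by
    intro x
    simp only [hG]
    have hi : ∀ k ∈ Finset.univ,
        Integrable (fun a => e (x k - a)) (volume.restrict (Set.Icc 0 L)) := fun k _ =>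
      (he.comp (by fun_prop : Continuous fun a : ℝ => x k - a)).continuousOn.integrableOn_compact
        isCompact_Icc
    rw [integral_mul_const, integral_finsetSum _ hi]
    congr 1
    have h : ∀ k, ∫ a in Set.Icc 0 L, e (x k - a) = ∫ t in (0)..L, e t := fun k => by
      rw [integral_Icc_eq_integral_Ioc, ← intervalIntegral.integral_of_le hL.le,
        intervalIntegral.integral_comp_sub_left (fun t => e t), sub_zero]
      have h := hep.intervalIntegral_add_eq (x k - L) 0
      rwa [sub_add_cancel, zero_add] at h
    rw [Finset.sum_congr rfl fun k _ => h k]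
    simp
  rw [setAverage_eq]
  simp only [Function.uncurry_apply_pair]
  rw [integral_integral_swap hint]
  simp_rw [hinner]
  rw [integral_const_mul, Real.volume_real_Icc_of_le hL.le, sub_zero, smul_eq_mul]
  ring

end Translation

/-! ### Dirichlet energy in the larger box against periodic energy -/

section Comparison

variable {N : ℕ} {V : Space → ℝ} {L ℓ : ℝ}

theorem permute_add_diagonal (σ : Equiv.Perm (Fin N)) (x : Config N) (a : ℝ) :
    permute σ x + diagonal _ a = permute σ (x + diagonal _ a) := rfl

theorem pairPotential_add_diagonal (W : Space → ℝ) (x : Config N) (a : ℝ) :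
    pairPotential W (x + diagonal _ a) = pairPotential W x := by
  have h : ∀ i, particle (x + diagonal _ a) i = particle x i + diagonal _ a := fun i => rfl
  simp only [pairPotential, h, add_sub_add_right_eq_sub]

theorem laplacian_comp_add {ι : Type*} [Fintype ι] [DecidableEq ι] {ψ : EuclideanSpace ℝ ι → ℂ}
    (hψ : ContDiff ℝ 2 ψ) (c x : EuclideanSpace ℝ ι) :
    (Δ fun x => ψ (x + c)) x = (Δ ψ) (x + c) := by
  rw [laplacian_eq_sum_pd (f := fun x => ψ (x + c)) (hψ.comp (contDiff_id.add contDiff_const)), laplacian_eq_sum_pd hψ]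
  simp_rw [pd_comp_add]

theorem re_conj_mul_hamiltonianExpr (W : Space → ℝ) (ψ : Config N → ℂ) (x : Config N) :
    (starRingEnd ℂ (ψ x) * hamiltonianExpr W ψ x).re =
      (starRingEnd ℂ (ψ x) * -(Δ ψ) x).re + pairPotential W x * ‖ψ x‖ ^ 2 := by
  rw [hamiltonianExpr_eq, mul_add, Complex.add_re]
  congr 1
  rw [mul_left_comm, Complex.conj_mul', Complex.re_ofReal_mul]
  norm_cast

/-- A periodic trial function for `[0, L]` gives a Dirichlet trial function for `[0, L + 2ℓ]`
with the same norm and at most the localization error of additional energy. -/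
theorem exists_dirichlet_trial (hV : IsInteractionPotential V) (hℓ : 0 < ℓ) (hL : ℓ ≤ L)
    {ψ : Config N → ℂ} (hψ : ψ ∈ periodicCore N L)
    (hσ : ∀ (σ : Equiv.Perm (Fin N)) x, ψ (permute σ x) = ψ x) :
    ∃ φ ∈ dirichletCore N (L + 2 * ℓ), (∀ (σ : Equiv.Perm (Fin N)) x, φ (permute σ x) = φ x) ∧
      ∫ x in cube (Fin N × Fin 3) (L + 2 * ℓ), ‖φ x‖ ^ 2 =
        ∫ x in cube (Fin N × Fin 3) L, ‖ψ x‖ ^ 2 ∧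
      ∫ x in cube (Fin N × Fin 3) (L + 2 * ℓ), (starRingEnd ℂ (φ x) * hamiltonianExpr V φ x).re ≤
        (∫ x in cube (Fin N × Fin 3) L,
          (starRingEnd ℂ (ψ x) * hamiltonianExpr (periodize V L) ψ x).re) +
        3 * N * ((∫ t, -(cutoff L ℓ t * deriv (deriv (cutoff L ℓ)) t)) / L) *
          ∫ x in cube (Fin N × Fin 3) L, ‖ψ x‖ ^ 2 := by
  have hL0 : 0 < L := hℓ.trans_le hL
  obtain ⟨hψc, hψp⟩ := hψ
  have hψp : IsPeriodic L ψ := hψp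
  have hψ2 := hψc.two_of_infty
  set q := cutoff L ℓ
  have hq : ContDiff ℝ 2 q := contDiff_cutoff (n := 2)
  have hqs : HasCompactSupport q := hasCompactSupport_cutoff hℓ
  have hq1 : ∀ t, periodization (fun t => q t * q t) L t = 1 := fun t => by
    simp_rw [← sq]; exact periodization_cutoff_sq hℓ hL t
  have hpc : Continuous fun t => q t * q t := hq.continuous.mul hq.continuous
  have hps : HasCompactSupport fun t => q t * q t := hqs.mul_right
  set r : ℝ → ℝ := fun t => -(q t * deriv (deriv q) t)
  have hr : Continuous r := (hq.continuous.mul (hq.iterate_deriv' 0 2).continuous).neg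
  have hrs : HasCompactSupport r :=
    (hqs.mul_right : HasCompactSupport fun t => q t * deriv (deriv q) t).neg
  set e := periodization r L
  have he : Continuous e := continuous_periodization hr hrs hL0
  have hep : Function.Periodic e L := periodization_periodic r L
  have hN : Continuous fun x => ‖ψ x‖ ^ 2 := hψ2.continuous.norm.pow 2
  have hNp : IsPeriodic L fun x => ‖ψ x‖ ^ 2 := fun x k => by simp only [hψp x k]
  -- The shift is chosen for the density |ψ|², with e the localization error density.
  obtain ⟨a, ha⟩ := exists_average_le hL0 he hep hN
  rw [integral_periodization hr hrs hL0] at ha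
  set c : Config N := diagonal _ a with hc
  set ψa : Config N → ℂ := fun x => ψ (x + c) with hψa
  have hψa2 : ContDiff ℝ 2 ψa := hψ2.comp (contDiff_id.add contDiff_const)
  have hψap : IsPeriodic L ψa := hψp.comp_add c
  have hNa : Continuous fun x => ‖ψa x‖ ^ 2 := hψa2.continuous.norm.pow 2
  set Q : Config N → ℝ := prodFun fun _ => q
  set φ : Config N → ℂ := fun x => Q x • ψa x with hφ
  have hQs : HasCompactSupport Q := hasCompactSupport_prodFun fun _ => hqs
  have hφs : HasCompactSupport φ := hQs.smul_right
  have hφt : tsupport φ ⊆ {x | ∀ k, x k ∈ Set.Ioo 0 (L + 2 * ℓ)} :=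
    (tsupport_smul_subset_left Q ψa).trans ((tsupport_prodFun_subset _).trans
      fun x hx k => tsupport_cutoff_subset hℓ (hx k))
  have hφcube : tsupport φ ⊆ cube _ (L + 2 * ℓ) :=
    hφt.trans fun x hx k => Set.Ioo_subset_Icc_self (hx k)
  have hφ2 : ContDiff ℝ 2 φ := (contDiff_prodFun fun _ => hq).smul hψa2
  have hφN : ∀ x, ‖φ x‖ ^ 2 = prodFun (fun _ t => q t * q t) x • ‖ψa x‖ ^ 2 := fun x => by
    rw [hφ, norm_smul, mul_pow, Real.norm_eq_abs, sq_abs, smul_eq_mul, ← prodFun_mul, sq (Q x)]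
  have hout : ∀ x ∉ cube (Fin N × Fin 3) (L + 2 * ℓ), φ x = 0 := fun x hx => by
    by_contra h
    exact hx (hφcube (subset_tsupport _ h))
  have hnorm_a : ∫ x in cube (Fin N × Fin 3) L, ‖ψa x‖ ^ 2 =
      ∫ x in cube (Fin N × Fin 3) L, ‖ψ x‖ ^ 2 := integral_cube_comp_add hL0 hN hNp a
  refine ⟨φ, ⟨?_, hφs, hφt⟩, fun σ x => ?_, ?_, ?_⟩
  · exact (contDiff_prodFun fun _ => contDiff_cutoff).smul
      (hψc.comp (contDiff_id.add contDiff_const))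
  · have h1 : Q (permute σ x) = Q x :=
      Fintype.prod_equiv (Equiv.prodCongr σ (Equiv.refl (Fin 3))) _ _ fun k => rfl
    simp only [hφ, hψa, h1, hc, permute_add_diagonal, hσ]
  · rw [setIntegral_eq_integral_of_forall_compl_eq_zero fun x hx => by rw [hout x hx]; simp]
    simp_rw [hφN]
    rw [integral_prodFun_smul_of_partition hL0 hpc hps hq1 hNa fun x k => by rw [hψap x k],
      hnorm_a]
  · rw [setIntegral_eq_integral_of_forall_compl_eq_zero fun x hx => by rw [hout x hx]; simp]
    simp_rw [re_conj_mul_hamiltonianExpr]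
    have hVc : Continuous V := hV.smooth.continuous
    have hPc := hV.continuous_periodize hL0
    set U : Config N → ℝ := pairPotential (periodize V L)
    have hU : Continuous U := continuous_pairPotential hPc
    have hUp : IsPeriodic L U := isPeriodic_pairPotential V L
    have hUN : Continuous fun x => U x * ‖ψ x‖ ^ 2 := hU.mul hN
    set A : Config N → ℝ := fun x => (starRingEnd ℂ (ψ x) * -(Δ ψ) x).re
    have hA : Continuous A := Complex.continuous_re.comp
      ((Complex.continuous_conj.comp hψ2.continuous).mul hψ2.continuous_laplacian.neg)
    have hAp : IsPeriodic L A := fun x k => by simp only [A, hψp x k, hψp.laplacian hψ2 x k]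
    have hkin_c : HasCompactSupport fun x => (starRingEnd ℂ (φ x) * -(Δ φ) x).re := by
      refine hφs.mono fun x hx h => hx ?_
      simp [h]
    have hkin_i : Integrable fun x => (starRingEnd ℂ (φ x) * -(Δ φ) x).re :=
      (Complex.continuous_re.comp ((Complex.continuous_conj.comp hφ2.continuous).mul
        hφ2.continuous_laplacian.neg)).integrable_of_hasCompactSupport hkin_c
    have hφNs : HasCompactSupport fun x => ‖φ x‖ ^ 2 :=
      hφs.comp_left (g := fun z => ‖z‖ ^ 2) (by simp)
    have hpot_i : ∀ {W : Space → ℝ}, Continuous W →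
        Integrable fun x => pairPotential W x * ‖φ x‖ ^ 2 := fun hW =>
      ((continuous_pairPotential hW).mul (hφ2.continuous.norm.pow 2)).integrable_of_hasCompactSupport
        hφNs.mul_left
    have hkin := integral_kinetic_prodFun_smul hL0 hq hqs hq1 hψa2 hψap
    have hkin_a : ∫ x in cube (Fin N × Fin 3) L, (starRingEnd ℂ (ψa x) * -(Δ ψa) x).re =
        ∫ x in cube (Fin N × Fin 3) L, A x := by
      rw [← integral_cube_comp_add hL0 hA hAp a]
      simp only [A, hψa, laplacian_comp_add hψ2, hc]
    -- Translating back moves the shift from ψ to the argument of e, the form in which a was chosen.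
    have herr : ∑ k, ∫ x in cube (Fin N × Fin 3) L, e (x k) * ‖ψa x‖ ^ 2 =
        ∫ x in cube (Fin N × Fin 3) L, (∑ k, e (x k - a)) * ‖ψ x‖ ^ 2 := by
      have hG : Continuous fun x : Config N => (∑ k, e (x k - a)) * ‖ψ x‖ ^ 2 :=
        (continuous_finsetSum _ fun k _ => he.comp (by fun_prop)).mul hN
      have hGp : IsPeriodic L fun x : Config N => (∑ k, e (x k - a)) * ‖ψ x‖ ^ 2 := fun x k => by
        simp only [hψp x k]
        congr 1
        refine Finset.sum_congr rfl fun j _ => ?_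
        rw [PiLp.add_apply, PiLp.single_apply]
        split_ifs
        · rw [add_sub_right_comm, hep]
        · rw [add_zero]
      have hi : ∀ k ∈ Finset.univ, Integrable (fun x => e (x k) * ‖ψa x‖ ^ 2)
          (volume.restrict (cube (Fin N × Fin 3) L)) := fun k _ =>
        ((he.comp (by fun_prop : Continuous fun x : Config N => x k)).mul hNa).integrableOn_cube
      rw [← integral_cube_comp_add hL0 hG hGp a, ← integral_finsetSum _ hi]
      simp_rw [Finset.sum_mul]
      simp [hψa, hc, diagonal]
    -- V is replaced by its periodization before unfolding, because only the latter gives a periodic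
    -- integrand; nonnegativity of V makes this an upper bound.
    have hpot : ∫ x, pairPotential V x * ‖φ x‖ ^ 2 ≤
        ∫ x in cube (Fin N × Fin 3) L, U x * ‖ψ x‖ ^ 2 := by
      calc ∫ x, pairPotential V x * ‖φ x‖ ^ 2 ≤ ∫ x, U x * ‖φ x‖ ^ 2 :=
            integral_mono (hpot_i hVc) (hpot_i hPc) fun x =>
              mul_le_mul_of_nonneg_right (pairPotential_mono (hV.le_periodize hL0) x)
                (by positivity)
        _ = ∫ x, prodFun (fun _ t => q t * q t) x • (U x * ‖ψa x‖ ^ 2) := by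
            simp_rw [hφN, smul_eq_mul, mul_left_comm]
        _ = ∫ x in cube (Fin N × Fin 3) L, U x * ‖ψa x‖ ^ 2 :=
            integral_prodFun_smul_of_partition hL0 hpc hps hq1 (hU.mul hNa) fun x k => by
              rw [hψap x k, hUp x k]
        _ = ∫ x in cube (Fin N × Fin 3) L, U x * ‖ψ x‖ ^ 2 := by
            rw [← integral_cube_comp_add hL0 hUN (fun x k => by
              simp only [hψp x k, hUp x k]) a]
            simp only [U, pairPotential_add_diagonal, hψa, hc]
    rw [integral_add hkin_i (hpot_i hVc), integral_add hA.integrableOn_cube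
      hUN.integrableOn_cube, hkin, hkin_a, herr]
    have hcard : (Fintype.card (Fin N × Fin 3) : ℝ) = 3 * N := by
      simp [mul_comm]
    rw [hcard] at ha
    linarith

/-- A nearly optimal periodic core function exists by one half of the variational principle. Its
localization is a Dirichlet core function, to which the other half applies. -/
theorem exists_infSpec_dirichlet_le (hV : IsInteractionPotential V) :
    ∃ C : ℝ, 0 ≤ C ∧ ∀ (N : ℕ) (L ℓ : ℝ), 0 < ℓ → ℓ ≤ L →
      infSpec (dirichletHamiltonian V N (L + 2 * ℓ)) ≤
        infSpec (periodicHamiltonian V N L) + 3 * N * (C / (ℓ * L)) := by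
  obtain ⟨C, hC, hCle⟩ := exists_integral_cutoff_le
  refine ⟨C, hC, fun N L ℓ hℓ hL => ?_⟩
  have hL0 : 0 < L := hℓ.trans_le hL
  have hPc := hV.continuous_periodize hL0
  have hVc : Continuous V := hV.smooth.continuous
  have hP := (isCore_periodicCore (N := N) hL0).isNonnegSymmetric hPc fun x =>
    (hV.nonneg x).trans (hV.le_periodize hL0 x)
  have hD := (isCore_dirichletCore (N := N) (L := L + 2 * ℓ)).isNonnegSymmetric hVc hV.nonneg
  -- The constant function 1 is periodic, symmetric and of positive norm.
  have hne : ∃ p ∈ hamiltonianSubmodule (isCore_periodicCore (N := N) hL0) (periodize V L),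
      p.1 ≠ 0 := by
    obtain ⟨p, hp, hp1, -⟩ := exists_mem_hamiltonianSubmodule (isCore_periodicCore (N := N) hL0)
      hPc (ψ := fun _ => 1) ⟨contDiff_const, fun _ _ => rfl⟩ fun _ _ => rfl
    refine ⟨p, hp, fun h0 => ?_⟩
    have h := norm_sq_bosonSpace hp1
    rw [h0] at h
    simp only [norm_zero, norm_one, one_pow, ne_eq, OfNat.ofNat_ne_zero, not_false_eq_true,
      zero_pow, setIntegral_const, smul_eq_mul, mul_one] at h
    exact (volume_cube_pos hL0).ne h
  refine le_of_forall_pos_lt_add fun ε hε => ?_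
  obtain ⟨p, ⟨ψ, hψ, hσ, hp1, hp2⟩, hp0, hlt⟩ := hP.exists_rayleigh_lt hne
    (lt_add_of_pos_right (infSpec (periodicHamiltonian V N L)) hε)
  obtain ⟨φ, hφ, hφσ, hnorm, hle⟩ := exists_dirichlet_trial hV hℓ hL hψ hσ
  obtain ⟨p', hp', hp1', hp2'⟩ := exists_mem_hamiltonianSubmodule
    (isCore_dirichletCore (N := N) (L := L + 2 * ℓ)) hVc hφ hφσ
  rw [← norm_sq_bosonSpace hp1, ← norm_sq_bosonSpace hp1'] at hnorm
  have hpos : 0 < ‖p.1‖ ^ 2 := by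
    have := norm_pos_iff.mpr hp0
    positivity
  have hp0' : p'.1 ≠ 0 := by
    rw [← norm_pos_iff]
    rw [← hnorm] at hpos
    exact (norm_nonneg _).lt_of_ne fun h => by simp [← h] at hpos
  have hre : ∀ {L : ℝ} {W : Space → ℝ} (_ : Continuous W) {φ : Config N → ℂ}
      (_ : ContDiff ℝ ∞ φ) {p : bosonSpace N L × bosonSpace N L}
      (_ : (p.1 : Lp ℂ 2 (boxMeasure N L)) =ᵐ[boxMeasure N L] φ)
      (_ : (p.2 : Lp ℂ 2 (boxMeasure N L)) =ᵐ[boxMeasure N L] hamiltonianExpr W φ),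
      (inner ℂ p.1 p.2).re = ∫ x in cube (Fin N × Fin 3) L,
        (starRingEnd ℂ (φ x) * hamiltonianExpr W φ x).re := by
    intro L W hW φ hφ p h1 h2
    rw [inner_bosonSpace h1 h2]
    have hc : Continuous fun x => starRingEnd ℂ (φ x) * hamiltonianExpr W φ x :=
      (Complex.continuous_conj.comp hφ.continuous).mul
        (continuous_hamiltonianExpr hW hφ.two_of_infty)
    exact (integral_re hc.integrableOn_cube).symm
  rw [← hre hVc hφ.1 hp1' hp2', ← hre hPc hψ.1 hp1 hp2, ← norm_sq_bosonSpace hp1] at hle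
  refine (hD.infSpec_le hp' hp0').trans_lt ?_
  rw [hnorm, div_lt_iff₀ hpos]
  have hCL : (∫ t, -(cutoff L ℓ t * deriv (deriv (cutoff L ℓ)) t)) / L ≤ C / (ℓ * L) := by
    rw [← div_div]
    exact div_le_div_of_nonneg_right (hCle L ℓ hℓ) hL0.le
  have h3 : 3 * N * ((∫ t, -(cutoff L ℓ t * deriv (deriv (cutoff L ℓ)) t)) / L) * ‖p.1‖ ^ 2 ≤
      3 * N * (C / (ℓ * L)) * ‖p.1‖ ^ 2 := by gcongr
  nlinarith

end Comparison
-- Powers of ρ and the change of density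
section Scaling

variable {ρ : ℝ}

theorem boxSide_pos (hρ : 0 < ρ) : 0 < boxSide ρ := Real.rpow_pos_of_pos hρ _

theorem boxSide'_pos (hρ : 0 < ρ) : 0 < boxSide' ρ :=
  mul_pos (boxSide_pos hρ) (by have := Real.rpow_pos_of_pos hρ (25 / 48); linarith)

theorem density'_eq (hρ : 0 < ρ) : density' ρ = ρ / (1 + 2 * ρ ^ (25 / 48 : ℝ)) ^ 3 := by
  have h := (boxSide_pos hρ).ne'
  rw [density', boxSide', mul_pow]
  field_simp

theorem particleNumber_density' (hρ : 0 < ρ) :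
    particleNumber (density' ρ) (boxSide' ρ) = particleNumber ρ (boxSide ρ) := by
  have h := (boxSide'_pos hρ).ne'
  rw [particleNumber, particleNumber, density', div_mul_cancel₀ _ (pow_ne_zero 3 h)]

theorem exists_e0D_le {V : Space → ℝ} (hV : IsInteractionPotential V) :
    ∃ C : ℝ, 0 ≤ C ∧ ∀ ρ : ℝ, 0 < ρ → ρ ≤ 1 →
      e0D V (density' ρ) (boxSide' ρ) ≤ e0P V ρ (boxSide ρ) + C * ρ ^ (75 / 48 : ℝ) := by
  obtain ⟨C, hC, h⟩ := exists_infSpec_dirichlet_le hV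
  refine ⟨3 * C, by positivity, fun ρ hρ hρ1 => ?_⟩
  have hs : ρ ^ (25 / 48 : ℝ) ≤ 1 := Real.rpow_le_one hρ.le hρ1 (by norm_num)
  have hL := boxSide_pos hρ
  have hs0 := Real.rpow_pos_of_pos hρ (25 / 48)
  -- The choice ℓ = Lρ^(25/48) makes L + 2ℓ = L̃, and 1/(ℓL) = ρ^(100/48 - 25/48).
  have h := h (particleNumber ρ (boxSide ρ)) (boxSide ρ) (boxSide ρ * ρ ^ (25 / 48 : ℝ))
    (mul_pos hL hs0) (mul_le_of_le_one_right hL.le hs)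
  have hside : boxSide ρ + 2 * (boxSide ρ * ρ ^ (25 / 48 : ℝ)) = boxSide' ρ := by
    rw [boxSide']; ring
  have hpow : C / (boxSide ρ * ρ ^ (25 / 48 : ℝ) * boxSide ρ) = C * ρ ^ (75 / 48 : ℝ) := by
    rw [boxSide, ← Real.rpow_add hρ, ← Real.rpow_add hρ, div_eq_mul_inv, ← Real.rpow_neg hρ.le]
    norm_num
  rw [hside, hpow] at h
  rw [e0D, e0P, particleNumber_density' hρ]
  -- Without particles both energies per particle are 0 by division by zero.
  rcases (particleNumber ρ (boxSide ρ)).eq_zero_or_pos with hN | hN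
  · rw [hN]
    simp only [Nat.cast_zero, div_zero, zero_add]
    positivity
  · have hN : (0 : ℝ) < particleNumber ρ (boxSide ρ) := by exact_mod_cast hN
    rw [div_le_iff₀ hN, add_mul, div_mul_cancel₀ _ hN.ne']
    linarith

theorem sub_density'_le (hρ : 0 < ρ) :
    ρ - density' ρ ≤ 26 * ρ ^ (73 / 48 : ℝ) := by
  have hs0 := Real.rpow_pos_of_pos hρ (25 / 48)
  have h : ρ ^ (73 / 48 : ℝ) = ρ * ρ ^ (25 / 48 : ℝ) := by
    rw [← Real.rpow_one_add' hρ.le (by norm_num)]; norm_num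
  rw [density'_eq hρ, h]
  set s := ρ ^ (25 / 48 : ℝ)
  -- A crude constant: 26 = 3³ - 1 is the value of (1 + 2s)³ - 1 at s = 1, and 6 would already do.
  have h1 : ρ * (1 - 26 * s) ≤ ρ / (1 + 2 * s) ^ 3 := by
    rw [le_div_iff₀ (by positivity), mul_assoc]
    refine mul_le_of_le_one_right hρ.le ?_
    nlinarith [mul_pos hs0 hs0, pow_pos hs0 3, pow_pos hs0 4]
  linarith

/-- The energy excess per particle over `g ρ` in units of `g^{5/2} ρ^{3/2}` is changed by the
scaling `ρ ↦ ρ̃` only by lower order terms. -/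
theorem rescaled_excess_le {g C eP eD : ℝ} (hg : 0 < g) (hC : 0 ≤ C) (hρ : 0 < ρ) (hρ1 : ρ ≤ 1)
    (h : eD ≤ eP + C * ρ ^ (75 / 48 : ℝ)) :
    (eD - g * density' ρ) / (g ^ (5 / 2 : ℝ) * density' ρ ^ (3 / 2 : ℝ)) ≤
      ((eP - g * ρ) / (g ^ (5 / 2 : ℝ) * ρ ^ (3 / 2 : ℝ)) +
        (C + 26 * g) / g ^ (5 / 2 : ℝ) * ρ ^ (1 / 48 : ℝ)) *
        ((1 + 2 * ρ ^ (25 / 48 : ℝ)) ^ 3) ^ (3 / 2 : ℝ) := by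
  set r := (1 + 2 * ρ ^ (25 / 48 : ℝ)) ^ 3
  have hr0 : 0 < r := by positivity
  have h1 : ρ ^ (75 / 48 : ℝ) ≤ ρ ^ (73 / 48 : ℝ) :=
    Real.rpow_le_rpow_of_exponent_ge hρ hρ1 (by norm_num)
  -- The change of density is the dominant error, and it beats ρ^(3/2) by the factor ρ^(1/48).
  have h2 : ρ ^ (73 / 48 : ℝ) = ρ ^ (1 / 48 : ℝ) * ρ ^ (3 / 2 : ℝ) := by
    rw [← Real.rpow_add hρ]; norm_num
  have h3 := sub_density'_le hρ
  have hnum : eD - g * density' ρ ≤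
      (eP - g * ρ) + (C + 26 * g) * (ρ ^ (1 / 48 : ℝ) * ρ ^ (3 / 2 : ℝ)) := by
    rw [← h2]
    nlinarith [mul_le_mul_of_nonneg_left h1 hC, mul_le_mul_of_nonneg_left h3 hg.le]
  have hden : density' ρ ^ (3 / 2 : ℝ) = ρ ^ (3 / 2 : ℝ) / r ^ (3 / 2 : ℝ) := by
    rw [density'_eq hρ, Real.div_rpow hρ.le hr0.le]
  rw [hden, div_le_iff₀ (by positivity)]
  refine hnum.trans (le_of_eq ?_)
  field_simp

theorem tendsto_rpow_nhdsWithin_zero {a : ℝ} (ha : 0 < a) (S : Set ℝ) :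
    Tendsto (fun ρ : ℝ => ρ ^ a) (𝓝[S] 0) (𝓝 0) := by
  have h := (Real.continuous_rpow_const ha.le).tendsto 0
  rw [Real.zero_rpow ha.ne'] at h
  exact h.mono_left nhdsWithin_le_nhds

end Scaling

/-- An upper bound for a limit superior is preserved under asymptotically trivial corrections. -/
theorem limsup_coe_le_of_eventually_le {α : Type*} {l : Filter α} {u v s r : α → ℝ} {c : ℝ}
    (hu : limsup (fun x => (u x : EReal)) l ≤ (c : EReal)) (hs : Tendsto s l (𝓝 0))
    (hr : Tendsto r l (𝓝 1)) (hv : ∀ᶠ x in l, v x ≤ (u x + s x) * r x) :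
    limsup (fun x => (v x : EReal)) l ≤ (c : EReal) := by
  refine EReal.le_of_forall_lt_iff_le.mp fun b hb => ?_
  have hb : c < b := by exact_mod_cast hb
  -- Only an eventual upper bound c' on u is needed: the corrected bound (c' + s)r tends to c' < b,
  -- and r is eventually positive, so the inequality may be multiplied by it.
  obtain ⟨c', hc', hb'⟩ := exists_between hb
  have hlim : Tendsto (fun x => (c' + s x) * r x) l (𝓝 c') := by
    simpa using (tendsto_const_nhds.add hs).mul hr
  have hu' : ∀ᶠ x in l, (u x : EReal) < (c' : EReal) :=
    eventually_lt_of_limsup_lt (hu.trans_lt (by exact_mod_cast hc'))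
  refine limsup_le_of_le (by isBoundedDefault) ?_
  filter_upwards [hu', hv, hlim.eventually_lt_const hb', hr.eventually_const_lt one_pos]
    with x hux hvx hlx hrx
  have hux : u x < c' := by exact_mod_cast hux
  have h : v x ≤ b := hvx.trans ((mul_le_mul_of_nonneg_right (by linarith) hrx.le).trans hlx.le)
  exact_mod_cast h

theorem g0_nonneg {V w : Space → ℝ} (hV : IsInteractionPotential V)
    (hw : IsScatteringSolution V w) : 0 ≤ g0 V w := by
  have h : 0 ≤ ∫ x, V x * (1 - w x) :=
    integral_nonneg fun x => mul_nonneg (hV.nonneg x) (sub_nonneg.mpr (hw.lt_one x).le)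
  have := Real.pi_pos
  unfold g0 scatteringLength
  positivity

end BoseGas

/-! ### The limit superior -/

theorem lemma2 (V w : BoseGas.Space → ℝ) (hV : BoseGas.IsInteractionPotential V)
    (hw : BoseGas.IsScatteringSolution V w)
    (hP : limsup (fun ρ : ℝ =>
        (((BoseGas.e0P V ρ (BoseGas.boxSide ρ) - BoseGas.g0 V w * ρ) /
          (BoseGas.g0 V w ^ (5 / 2 : ℝ) * ρ ^ (3 / 2 : ℝ)) : ℝ) : EReal))
        (𝓝[BoseGas.admissibleDensities] 0) ≤ ((16 / (15 * Real.pi ^ 2) : ℝ) : EReal)) :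
    limsup (fun ρ : ℝ =>
        (((BoseGas.e0D V (BoseGas.density' ρ) (BoseGas.boxSide' ρ) -
            BoseGas.g0 V w * BoseGas.density' ρ) /
          (BoseGas.g0 V w ^ (5 / 2 : ℝ) * BoseGas.density' ρ ^ (3 / 2 : ℝ)) : ℝ) : EReal))
        (𝓝[BoseGas.admissibleDensities] 0) ≤ ((16 / (15 * Real.pi ^ 2) : ℝ) : EReal) := by
  rcases (BoseGas.g0_nonneg hV hw).eq_or_lt with hg | hg
  -- When g₀ = 0 the denominator vanishes, and the quotient takes the default value 0.
  · have h0 : (0 : ℝ) ≤ 16 / (15 * Real.pi ^ 2) := by positivity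
    rw [← hg, Real.zero_rpow (by norm_num)]
    simp only [zero_mul, div_zero]
    exact limsup_le_of_le (by isBoundedDefault) (.of_forall fun _ => by exact_mod_cast h0)
  · obtain ⟨C, hC, h⟩ := BoseGas.exists_e0D_le hV
    refine BoseGas.limsup_coe_le_of_eventually_le hP
      (s := fun ρ => (C + 26 * BoseGas.g0 V w) / BoseGas.g0 V w ^ (5 / 2 : ℝ) * ρ ^ (1 / 48 : ℝ))
      (r := fun ρ => ((1 + 2 * ρ ^ (25 / 48 : ℝ)) ^ 3) ^ (3 / 2 : ℝ)) ?_ ?_ ?_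
    · simpa using (BoseGas.tendsto_rpow_nhdsWithin_zero (a := 1 / 48) (by norm_num) _).const_mul
        ((C + 26 * BoseGas.g0 V w) / BoseGas.g0 V w ^ (5 / 2 : ℝ))
    · have h1 := (((BoseGas.tendsto_rpow_nhdsWithin_zero (a := 25 / 48) (by norm_num)
        BoseGas.admissibleDensities).const_mul 2).const_add 1).pow 3
      simpa using h1.rpow_const (p := 3 / 2) (Or.inr (by norm_num))
    · filter_upwards [self_mem_nhdsWithin, nhdsWithin_le_nhds (Iic_mem_nhds one_pos)]
        with ρ hρ hρ1
      exact BoseGas.rescaled_excess_le hg hC hρ.1 hρ1 (h ρ hρ.1 hρ1)
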